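/- Let $d\ge 1$, let $h>0$, and let $\mathbf A\in L^2_{\mathrm{loc}}(\mathbb R^d,\mathbb C^d)$. Assume that there are constants $a\in(0,1)$ and $b\ge 0$ such that $$\int_{\mathbb R^d}|(\operatorname{Im}\mathbf A)u|^2\,dx\le a\int_{\mathbb R^d}|(-ih\nabla-\operatorname{Re}\mathbf A)u|^2\,dx+b\int_{\mathbb R^d}|u|^2\,dx\qquad\text{for all }u\in C_c^\infty(\mathbb R^d).$$ Define the sesquilinear form $Q_{h,\mathbf A}$ in $L^2(\mathbb R^d)$ by $$\operatorname{Dom}(Q_{h,\mathbf A})=\{u\in L^2(\mathbb R^d):\ (-ih\nabla-\operatorname{Re}\mathbf A)u\in L^2(\mathbb R^d,\mathbb C^d),\ (\operatorname{Im}\mathbf A)u\in L^2(\mathbb R^d,\mathbb C^d)\},$$ $$Q_{h,\mathbf A}(u,v)=\int_{\mathbb R^d}(-ih\nabla-\mathbf A)u\cdot\overline{(-ih\nabla-\overline{\mathbf A})v}\,dx,$$ where $(-ih\nabla-\operatorname{Re}\mathbf A)u$, $(-ih\nabla-\mathbf A)u$ and $(-ih\nabla-\overline{\mathbf A})v$ are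 understood in the sense of distributions. Let $\langle f,v\rangle=\int_{\mathbb R^d} f\,\overline v\,dx$ and $\|v\|^2=\langle v,v\rangle$. Then $Q_{h,\mathbf A}$ is: (i) densely defined; (ii) closed: if $u_n\in\operatorname{Dom}(Q_{h,\mathbf A})$, $u_n\to u$ in $L^2(\mathbb R^d)$ and $Q_{h,\mathbf A}(u_n-u_m,u_n-u_m)\to0$ as $n,m\to\infty$, then $u\in\operatorname{Dom}(Q_{h,\mathbf A})$ and $Q_{h,\mathbf A}(u_n-u,u_n-u)\to0$; (iii) sectorial: there are $\gamma\in\mathbb R$ and $\theta\in[0,\pi/2)$ such that $Q_{h,\mathbf A}(u,u)$ lies in the sector $\{z\in\mathbb C:\ z=\gamma\text{ or }|\arg(z-\gamma)|\le\theta\}$ for every $u\in\operatorname{Dom}(Q_{h,\mathbf A})$ with $\|u\|=1$. Moreover, the operator $\mathscr L_{h,\mathbf A}$ in $L^2(\mathbb R^d)$ defined by $$\operatorname{Dom}(\mathscr L_{h,\mathbf A})=\{u\in\operatorname{Dom}(Q_{h,\mathbf A}):\ \exists f\in L^2(\mathbb R^d)\ \forall v\in\operatorname{Dom}(Q_{h,\mathbf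 A}),\ Q_{h,\mathbf A}(u,v)=\langle f,v\rangle\},\qquad \mathscr L_{h,\mathbf A}u=f,$$ is m-sectorial: it is densely defined and closed; there are $\gamma\in\mathbb R$ and $\theta\in[0,\pi/2)$ such that $\langle\mathscr L_{h,\mathbf A}u,u\rangle$ lies in the sector $\{z\in\mathbb C:\ z=\gamma\text{ or }|\arg(z-\gamma)|\le\theta\}$ for every $u\in\operatorname{Dom}(\mathscr L_{h,\mathbf A})$ with $\|u\|=1$; and, for some $\alpha\in\mathbb R$ and every $z\in\mathbb C$ with $\operatorname{Re}z>0$, the operator $\mathscr L_{h,\mathbf A}+\alpha+z$ has an everywhere defined bounded inverse of norm at most $1/\operatorname{Re}z$. -/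

import Mathlib

open MeasureTheory Filter Topology
open scoped ContDiff

/-! ### Sesquilinear forms and operators in a Hilbert space -/

/-- A (not necessarily everywhere defined) sesquilinear form in `H`: a subspace `domain` and a map
`(u, v) ↦ form u v` on it, linear in `u` and conjugate-linear in `v`. -/
structure SesqForm (H : Type*) [NormedAddCommGroup H] [InnerProductSpace ℂ H] where
  domain : Submodule ℂ H
  form : domain →ₗ[ℂ] domain →ₗ⋆[ℂ] ℂ

/-- The closed sector with vertex `γ` and semi-angle `θ` around the positive direction of the
real axis (it contains its vertex, as `Complex.arg 0 = 0`). -/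
def complexSector (γ θ : ℝ) : Set ℂ := {z | |(z - (γ : ℂ)).arg| ≤ θ}

namespace SesqForm

variable {H : Type*} [NormedAddCommGroup H] [InnerProductSpace ℂ H]

def IsDenselyDefined (t : SesqForm H) : Prop := Dense (t.domain : Set H)

/-- The numerical range of a form. -/
def numericalRange (t : SesqForm H) : Set ℂ :=
  {z | ∃ u : t.domain, ‖(u : H)‖ = 1 ∧ t.form u u = z}

/-- A form is sectorial if its numerical range lies in a sector of semi-angle less than `π / 2`. -/
def IsSectorial (t : SesqForm H) : Prop :=
  ∃ γ θ : ℝ, 0 ≤ θ ∧ θ < Real.pi / 2 ∧ t.numericalRange ⊆ complexSector γ θ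

/-- A form `t` is closed if `uₙ → u` in `H` with `uₙ` in the domain and
`t (uₙ - uₘ, uₙ - uₘ) → 0` as `n, m → ∞` imply that `u` is in the domain and
`t (uₙ - u, uₙ - u) → 0`. -/
def IsClosed (t : SesqForm H) : Prop :=
  ∀ (u : ℕ → t.domain) (x : H),
    Tendsto (fun n => (u n : H)) atTop (𝓝 x) →
    Tendsto (fun p : ℕ × ℕ => t.form (u p.1 - u p.2) (u p.1 - u p.2)) atTop (𝓝 0) →
    ∃ hx : x ∈ t.domain,
      Tendsto (fun n => t.form (u n - ⟨x, hx⟩) (u n - ⟨x, hx⟩)) atTop (𝓝 0)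

/-- The pairs `(u, f)` with `u` in the domain of `t` and `t (u, v) = ⟨f, v⟩` for all `v` in the
domain of `t`. Here `⟨f, v⟩` is linear in `f`, so it is `inner ℂ v f` in Mathlib's convention. -/
def operatorGraph (t : SesqForm H) : Submodule ℂ (H × H) where
  carrier := {p | ∃ hu : p.1 ∈ t.domain, ∀ v : t.domain, t.form ⟨p.1, hu⟩ v = inner ℂ (v : H) p.2}
  zero_mem' := ⟨t.domain.zero_mem, fun v => by
    have : (⟨(0 : H × H).1, t.domain.zero_mem⟩ : t.domain) = 0 := rfl
    rw [this]; simp⟩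
  add_mem' := by
    rintro p q ⟨hp, hp'⟩ ⟨hq, hq'⟩
    refine ⟨t.domain.add_mem hp hq, fun v => ?_⟩
    have : (⟨(p + q).1, t.domain.add_mem hp hq⟩ : t.domain) = ⟨p.1, hp⟩ + ⟨q.1, hq⟩ := rfl
    rw [this, map_add, LinearMap.add_apply, hp', hq', Prod.snd_add, inner_add_right]
  smul_mem' := by
    rintro c p ⟨hp, hp'⟩
    refine ⟨t.domain.smul_mem c hp, fun v => ?_⟩
    have : (⟨(c • p).1, t.domain.smul_mem c hp⟩ : t.domain) = c • ⟨p.1, hp⟩ := rfl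
    rw [this, map_smul, LinearMap.smul_apply, hp', Prod.smul_snd, inner_smul_right, smul_eq_mul]

/-- The operator associated with the form `t`: its domain consists of the `u` in the domain of `t`
for which there is `f` with `t (u, v) = ⟨f, v⟩` for all `v` in the domain of `t`, and it maps `u`
to `f` (which is unique as soon as `t` is densely defined). -/
noncomputable def operator (t : SesqForm H) : H →ₗ.[ℂ] H := t.operatorGraph.toLinearPMap

theorem graph_operator (t : SesqForm H) (ht : t.IsDenselyDefined) :
    t.operator.graph = t.operatorGraph := by
  refine Submodule.toLinearPMap_graph_eq _ ?_
  rintro ⟨u, f⟩ ⟨hu, hf⟩ (h0 : u = 0)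
  subst h0
  refine ht.eq_zero_of_inner_right (𝕜 := ℂ) fun v hv => ?_
  rw [← hf ⟨v, hv⟩]
  have : (⟨(0 : H), hu⟩ : t.domain) = 0 := rfl
  simp only [this, map_zero, LinearMap.zero_apply]

end SesqForm

namespace LinearPMap

variable {H : Type*} [NormedAddCommGroup H] [InnerProductSpace ℂ H]

/-- The numerical range of an operator: the values `⟨T u, u⟩` at unit vectors of the domain. -/
def numericalRange (T : H →ₗ.[ℂ] H) : Set ℂ :=
  {z | ∃ u : T.domain, ‖(u : H)‖ = 1 ∧ inner ℂ (u : H) (T u) = z}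

/-- An operator is sectorial if its numerical range lies in a sector of semi-angle less than
`π / 2`. -/
def IsSectorial (T : H →ₗ.[ℂ] H) : Prop :=
  ∃ γ θ : ℝ, 0 ≤ θ ∧ θ < Real.pi / 2 ∧ T.numericalRange ⊆ complexSector γ θ

/-- The bounded operator `R` is the inverse of `T + z`. -/
def IsInverseOfAdd (T : H →ₗ.[ℂ] H) (z : ℂ) (R : H →L[ℂ] H) : Prop :=
  (∀ f : H, ∃ hf : R f ∈ T.domain, T ⟨R f, hf⟩ + z • R f = f) ∧
    ∀ u : T.domain, R (T u + z • (u : H)) = u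

/-- `T` is quasi-m-accretive: for some real `α`, the operator `T + α` is m-accretive, i.e.
`(T + α + z)⁻¹` is bounded and everywhere defined with norm at most `1 / Re z` when `Re z > 0`. -/
def IsQuasiMAccretive (T : H →ₗ.[ℂ] H) : Prop :=
  ∃ α : ℝ, ∀ z : ℂ, 0 < z.re →
    ∃ R : H →L[ℂ] H, T.IsInverseOfAdd ((α : ℂ) + z) R ∧ ‖R‖ ≤ z.re⁻¹

/-- A densely defined closed operator is m-sectorial if it is sectorial and quasi-m-accretive. -/
def IsMSectorial (T : H →ₗ.[ℂ] H) : Prop :=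
  Dense (T.domain : Set H) ∧ T.IsClosed ∧ T.IsSectorial ∧ T.IsQuasiMAccretive

end LinearPMap

/-! ### The magnetic form -/

namespace Magnetic

variable {d : ℕ}

/-- The space `ℝ^d`. -/
abbrev Space (d : ℕ) : Type := EuclideanSpace ℝ (Fin d)

/-- The complex Hilbert space `L²(ℝ^d)`. -/
abbrev L2 (d : ℕ) : Type := Lp ℂ 2 (volume : Measure (Space d))

/-- `f ∈ L²_loc(ℝ^d, F)`. -/
def MemL2Loc {F : Type*} [NormedAddCommGroup F] (f : Space d → F) : Prop :=
  ∀ K : Set (Space d), IsCompact K → MemLp f 2 (volume.restrict K)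

/-- `φ ∈ C_c^∞(ℝ^d)`, complex-valued. -/
def IsTestFunction (φ : Space d → ℂ) : Prop := ContDiff ℝ ∞ φ ∧ HasCompactSupport φ

/-- The partial derivative `∂_j φ`. -/
noncomputable def partialDeriv (j : Fin d) (φ : Space d → ℂ) (x : Space d) : ℂ :=
  fderiv ℝ φ x (EuclideanSpace.single j 1)

/-- `(-i h ∂_j - c) u = w` in the sense of distributions. -/
def IsWeakMagneticDeriv (h : ℝ) (c : Space d → ℂ) (j : Fin d) (u w : L2 d) : Prop :=
  ∀ φ : Space d → ℂ, IsTestFunction φ →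
    ∫ x, w x * φ x = ∫ x, u x * (Complex.I * h * partialDeriv j φ x - c x * φ x)

theorem IsTestFunction.memLp {φ : Space d → ℂ} (hφ : IsTestFunction φ) :
    MemLp φ 2 (volume : Measure (Space d)) :=
  hφ.1.continuous.memLp_of_hasCompactSupport hφ.2

theorem IsTestFunction.memLp_partialDeriv {φ : Space d → ℂ} (hφ : IsTestFunction φ) (j : Fin d) :
    MemLp (partialDeriv j φ) 2 (volume : Measure (Space d)) := by
  have h1 : Continuous (partialDeriv j φ) :=
    (hφ.1.continuous_fderiv (by simp)).clm_apply continuous_const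
  exact h1.memLp_of_hasCompactSupport (hφ.2.fderiv_apply ℝ _)

theorem MemL2Loc.memLp_mul {c : Space d → ℂ} (hc : MemL2Loc c) {φ : Space d → ℂ}
    (hφ : IsTestFunction φ) : MemLp (fun x => c x * φ x) 2 (volume : Measure (Space d)) := by
  obtain ⟨C, hC⟩ := hφ.1.continuous.bounded_above_of_compact_support hφ.2
  have hK : MemLp (fun x => φ x * c x) 2 (volume.restrict (tsupport φ)) := by
    refine (hc _ hφ.2).of_le_mul (c := C)
      (hφ.1.continuous.aestronglyMeasurable.mul (hc _ hφ.2).1) (ae_of_all _ fun x => ?_)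
    rw [norm_mul]
    exact mul_le_mul_of_nonneg_right (hC x) (norm_nonneg _)
  have h2 := (memLp_indicator_iff_restrict (isClosed_tsupport φ).measurableSet).2 hK
  refine h2.ae_eq (ae_of_all _ fun x => ?_)
  by_cases hx : x ∈ tsupport φ
  · simp only [Set.indicator_of_mem hx, mul_comm]
  · simp only [Set.indicator_of_notMem hx, image_eq_zero_of_notMem_tsupport hx, mul_zero]

theorem integrable_weak {c : Space d → ℂ} (hc : MemL2Loc c) (h : ℝ) (j : Fin d) (u : L2 d)
    {φ : Space d → ℂ} (hφ : IsTestFunction φ) :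
    Integrable (fun x => u x * (Complex.I * h * partialDeriv j φ x - c x * φ x)) :=
  (Lp.memLp u).integrable_mul
    (((hφ.memLp_partialDeriv j).const_mul (Complex.I * h)).sub (hc.memLp_mul hφ))

theorem integrable_mul_test (u : L2 d) {φ : Space d → ℂ} (hφ : IsTestFunction φ) :
    Integrable (fun x => u x * φ x) :=
  (Lp.memLp u).integrable_mul hφ.memLp

/-- The graph of `-i h ∂_j - c` in `L²(ℝ^d)`, in the sense of distributions. -/
def weakGraph (h : ℝ) {c : Space d → ℂ} (hc : MemL2Loc c) (j : Fin d) :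
    Submodule ℂ (L2 d × L2 d) where
  carrier := {p | IsWeakMagneticDeriv h c j p.1 p.2}
  zero_mem' := fun φ _ => by
    have h0 := Lp.coeFn_zero ℂ 2 (volume : Measure (Space d))
    rw [integral_eq_zero_of_ae, integral_eq_zero_of_ae]
    · filter_upwards [h0] with x hx
      simp only [Prod.fst_zero, hx, Pi.zero_apply, zero_mul]
    · filter_upwards [h0] with x hx
      simp only [Prod.snd_zero, hx, Pi.zero_apply, zero_mul]
  add_mem' := by
    intro p q hp hq φ hφ
    have e1 : ∫ x, (p + q).2 x * φ x = ∫ x, (p.2 x * φ x + q.2 x * φ x) := by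
      refine integral_congr_ae ?_
      filter_upwards [Lp.coeFn_add p.2 q.2] with x hx
      simp only [Prod.snd_add, hx, Pi.add_apply, add_mul]
    have e2 : ∫ x, (p + q).1 x * (Complex.I * h * partialDeriv j φ x - c x * φ x) =
        ∫ x, (p.1 x * (Complex.I * h * partialDeriv j φ x - c x * φ x) +
          q.1 x * (Complex.I * h * partialDeriv j φ x - c x * φ x)) := by
      refine integral_congr_ae ?_
      filter_upwards [Lp.coeFn_add p.1 q.1] with x hx
      simp only [Prod.fst_add, hx, Pi.add_apply, add_mul]
    rw [e1, e2, integral_add (integrable_mul_test _ hφ) (integrable_mul_test _ hφ),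
      integral_add (integrable_weak hc h j _ hφ) (integrable_weak hc h j _ hφ), hp φ hφ, hq φ hφ]
  smul_mem' := by
    intro a p hp φ hφ
    have e1 : ∫ x, (a • p).2 x * φ x = ∫ x, a * (p.2 x * φ x) := by
      refine integral_congr_ae ?_
      filter_upwards [Lp.coeFn_smul a p.2] with x hx
      simp only [Prod.smul_snd, hx, Pi.smul_apply, smul_eq_mul, mul_assoc]
    have e2 : ∫ x, (a • p).1 x * (Complex.I * h * partialDeriv j φ x - c x * φ x) =
        ∫ x, a * (p.1 x * (Complex.I * h * partialDeriv j φ x - c x * φ x)) := by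
      refine integral_congr_ae ?_
      filter_upwards [Lp.coeFn_smul a p.1] with x hx
      simp only [Prod.smul_fst, hx, Pi.smul_apply, smul_eq_mul, mul_assoc]
    rw [e1, e2, integral_const_mul, integral_const_mul, hp φ hφ]

/-- The operator `u ↦ (-i h ∂_j - c) u` in `L²(ℝ^d)`, in the sense of distributions, on the
maximal domain of all `u ∈ L²(ℝ^d)` for which `(-i h ∂_j - c) u` is in `L²(ℝ^d)`. -/
noncomputable def weakDeriv (h : ℝ) {c : Space d → ℂ} (hc : MemL2Loc c) (j : Fin d) :
    L2 d →ₗ.[ℂ] L2 d :=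
  (weakGraph h hc j).toLinearPMap

theorem graph_weakDeriv (h : ℝ) {c : Space d → ℂ} (hc : MemL2Loc c) (j : Fin d) :
    (weakDeriv h hc j).graph = weakGraph h hc j := by
  refine Submodule.toLinearPMap_graph_eq _ ?_
  rintro ⟨u, w⟩ huw (h0 : u = 0)
  subst h0
  have key : ∀ᵐ x : Space d, w x = 0 := by
    refine ae_eq_zero_of_integral_contDiff_smul_eq_zero
      ((Lp.memLp w).locallyIntegrable (by norm_num)) fun g hg hgc => ?_
    have hφ : IsTestFunction (fun x => (g x : ℂ)) :=
      ⟨Complex.ofRealCLM.contDiff.comp hg, hgc.comp_left (g := Complex.ofReal) rfl⟩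
    have := huw _ hφ
    simp only [Complex.real_smul]
    simp only [mul_comm ((g _ : ℝ) : ℂ)]
    rw [this]
    refine integral_eq_zero_of_ae ?_
    filter_upwards [Lp.coeFn_zero ℂ 2 (volume : Measure (Space d))] with x hx
    simp only [hx, Pi.zero_apply, zero_mul]
  exact (Lp.eq_zero_iff_ae_eq_zero).2 key

theorem mem_domain_weakDeriv (h : ℝ) {c : Space d → ℂ} (hc : MemL2Loc c) (j : Fin d) (u : L2 d) :
    u ∈ (weakDeriv h hc j).domain ↔ ∃ w, IsWeakMagneticDeriv h c j u w := by
  rw [LinearPMap.mem_domain_iff, graph_weakDeriv]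
  rfl

theorem weakDeriv_spec (h : ℝ) {c : Space d → ℂ} (hc : MemL2Loc c) (j : Fin d)
    (u : (weakDeriv h hc j).domain) : IsWeakMagneticDeriv h c j u (weakDeriv h hc j u) := by
  have := LinearPMap.mem_graph (weakDeriv h hc j) u
  rw [graph_weakDeriv] at this
  exact this

/-- The multiplication of elements of `L²(ℝ^d)` by `e` has as maximal domain the `u` with
`e u ∈ L²(ℝ^d)`. -/
def mulDomain (e : Space d → ℂ) : Submodule ℂ (L2 d) where
  carrier := {u | MemLp (fun x => e x * u x) 2 (volume : Measure (Space d))}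
  zero_mem' := by
    refine (MemLp.zero (p := 2) (μ := (volume : Measure (Space d))) (ε := ℂ)).ae_eq ?_
    filter_upwards [Lp.coeFn_zero ℂ 2 (volume : Measure (Space d))] with x hx
    simp only [hx, Pi.zero_apply, mul_zero]
  add_mem' := by
    intro u v hu hv
    refine (MemLp.add hu hv).ae_eq ?_
    filter_upwards [Lp.coeFn_add u v] with x hx
    simp only [hx, Pi.add_apply, mul_add]
  smul_mem' := by
    intro a u hu
    refine (MemLp.const_mul hu a).ae_eq ?_
    filter_upwards [Lp.coeFn_smul a u] with x hx
    simp only [hx, Pi.smul_apply, smul_eq_mul, mul_left_comm]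

/-- The component functions `A_j`, `conj A_j`, `Re A_j` and `Im A_j` of a potential `A`. -/
def comp (A : Space d → EuclideanSpace ℂ (Fin d)) (j : Fin d) (x : Space d) : ℂ := A x j

noncomputable def conjComp (A : Space d → EuclideanSpace ℂ (Fin d)) (j : Fin d) (x : Space d) : ℂ :=
  starRingEnd ℂ (A x j)

def reComp (A : Space d → EuclideanSpace ℂ (Fin d)) (j : Fin d) (x : Space d) : ℂ :=
  ((A x j).re : ℂ)

def imComp (A : Space d → EuclideanSpace ℂ (Fin d)) (j : Fin d) (x : Space d) : ℂ :=
  ((A x j).im : ℂ)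

theorem MemL2Loc.comp {A : Space d → EuclideanSpace ℂ (Fin d)} (hA : MemL2Loc A) (j : Fin d) :
    MemL2Loc (comp A j) := fun K hK =>
  (EuclideanSpace.proj j : EuclideanSpace ℂ (Fin d) →L[ℂ] ℂ).comp_memLp' (hA K hK)

theorem MemL2Loc.conjComp {A : Space d → EuclideanSpace ℂ (Fin d)} (hA : MemL2Loc A) (j : Fin d) :
    MemL2Loc (conjComp A j) := fun K hK => (hA.comp j K hK).star

theorem MemL2Loc.reComp {A : Space d → EuclideanSpace ℂ (Fin d)} (hA : MemL2Loc A) (j : Fin d) :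
    MemL2Loc (reComp A j) := fun K hK => (hA.comp j K hK).re.ofReal

theorem MemL2Loc.imComp {A : Space d → EuclideanSpace ℂ (Fin d)} (hA : MemL2Loc A) (j : Fin d) :
    MemL2Loc (imComp A j) := fun K hK => (hA.comp j K hK).im.ofReal

/-- The form domain: all `u ∈ L²(ℝ^d)` with `(-i h ∇ - Re A) u ∈ L²(ℝ^d, ℂ^d)` (in the sense of
distributions) and `(Im A) u ∈ L²(ℝ^d, ℂ^d)`. -/
noncomputable def formDomain (h : ℝ) {A : Space d → EuclideanSpace ℂ (Fin d)} (hA : MemL2Loc A) :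
    Submodule ℂ (L2 d) :=
  (⨅ j, (weakDeriv h (hA.reComp j) j).domain) ⊓ ⨅ j, mulDomain (imComp A j)

theorem mem_formDomain (h : ℝ) {A : Space d → EuclideanSpace ℂ (Fin d)} (hA : MemL2Loc A)
    (u : L2 d) :
    u ∈ formDomain h hA ↔ (∀ j, ∃ w, IsWeakMagneticDeriv h (reComp A j) j u w) ∧
      ∀ j, MemLp (fun x => imComp A j x * u x) 2 (volume : Measure (Space d)) := by
  simp only [formDomain, Submodule.mem_inf, Submodule.mem_iInf, mem_domain_weakDeriv]
  rfl

theorem exists_weak_add {h : ℝ} {c e : Space d → ℂ} (hc : MemL2Loc c) (k : ℂ)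
    {j : Fin d} {u : L2 d}
    (h1 : ∃ w, IsWeakMagneticDeriv h c j u w)
    (h2 : MemLp (fun x => e x * u x) 2 (volume : Measure (Space d))) :
    ∃ w, IsWeakMagneticDeriv h (fun x => c x + k * e x) j u w := by
  obtain ⟨w, hw⟩ := h1
  have h3 := h2.const_mul k
  refine ⟨w - h3.toLp _, fun φ hφ => ?_⟩
  have e1 : ∫ x, (w - h3.toLp _) x * φ x = ∫ x, (w x * φ x - k * (e x * u x) * φ x) := by
    refine integral_congr_ae ?_
    filter_upwards [Lp.coeFn_sub w (h3.toLp _), h3.coeFn_toLp] with x hx hx'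
    simp only [hx, Pi.sub_apply, hx', sub_mul]
  have i3 : Integrable (fun x => k * (e x * u x) * φ x) := h3.integrable_mul hφ.memLp
  rw [e1, integral_sub (integrable_mul_test _ hφ) i3, hw φ hφ,
    ← integral_sub (integrable_weak hc h j _ hφ) i3]
  refine integral_congr_ae (ae_of_all _ fun x => ?_)
  ring

theorem formDomain_le (h : ℝ) {A : Space d → EuclideanSpace ℂ (Fin d)} (hA : MemL2Loc A)
    (j : Fin d) : formDomain h hA ≤ (weakDeriv h (hA.comp j) j).domain := by
  intro u hu
  rw [mem_formDomain] at hu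
  rw [mem_domain_weakDeriv]
  convert exists_weak_add (hA.reComp j) Complex.I (hu.1 j) (hu.2 j) using 4 with w
  refine Complex.ext ?_ ?_ <;> simp [comp, reComp, imComp]

theorem formDomain_le_conj (h : ℝ) {A : Space d → EuclideanSpace ℂ (Fin d)} (hA : MemL2Loc A)
    (j : Fin d) : formDomain h hA ≤ (weakDeriv h (hA.conjComp j) j).domain := by
  intro u hu
  rw [mem_formDomain] at hu
  rw [mem_domain_weakDeriv]
  convert exists_weak_add (hA.reComp j) (-Complex.I) (hu.1 j) (hu.2 j) using 4 with w
  refine Complex.ext ?_ ?_ <;> simp [conjComp, reComp, imComp]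

/-- `u ↦ (-i h ∂_j - A_j) u` on the form domain. -/
noncomputable def derivA (h : ℝ) {A : Space d → EuclideanSpace ℂ (Fin d)} (hA : MemL2Loc A)
    (j : Fin d) : formDomain h hA →ₗ[ℂ] L2 d :=
  (weakDeriv h (hA.comp j) j).toFun ∘ₗ Submodule.inclusion (formDomain_le h hA j)

/-- `v ↦ (-i h ∂_j - conj A_j) v` on the form domain. -/
noncomputable def derivConjA (h : ℝ) {A : Space d → EuclideanSpace ℂ (Fin d)} (hA : MemL2Loc A)
    (j : Fin d) : formDomain h hA →ₗ[ℂ] L2 d :=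
  (weakDeriv h (hA.conjComp j) j).toFun ∘ₗ Submodule.inclusion (formDomain_le_conj h hA j)

/-- The magnetic form
`Q (u, v) = ∫ (-i h ∇ - A) u ⬝ conj ((-i h ∇ - conj A) v) dx`, on the form domain. The inner
product of `L²` is conjugate-linear in its first argument. -/
noncomputable def magneticForm (h : ℝ) {A : Space d → EuclideanSpace ℂ (Fin d)}
    (hA : MemL2Loc A) : SesqForm (L2 d) where
  domain := formDomain h hA
  form := LinearMap.mk₂'ₛₗ (RingHom.id ℂ) (starRingEnd ℂ)
    (fun u v => ∑ j, inner ℂ (derivConjA h hA j v) (derivA h hA j u))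
    (fun u u' v => by simp only [map_add, inner_add_right, Finset.sum_add_distrib])
    (fun a u v => by
      simp only [map_smul, inner_smul_right, Finset.mul_sum, RingHom.id_apply, smul_eq_mul])
    (fun u v v' => by simp only [map_add, inner_add_left, Finset.sum_add_distrib])
    (fun a u v => by simp only [map_smul, inner_smul_left, Finset.mul_sum, smul_eq_mul])

theorem magneticForm_apply (h : ℝ) {A : Space d → EuclideanSpace ℂ (Fin d)}
    (hA : MemL2Loc A) (u v : formDomain h hA) :
    (magneticForm h hA).form u v =
      ∫ x, ∑ j, derivA h hA j u x * starRingEnd ℂ (derivConjA h hA j v x) := by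
  have i (j : Fin d) := L2.integrable_inner (𝕜 := ℂ) (derivConjA h hA j v) (derivA h hA j u)
  simp only [RCLike.inner_apply] at i
  rw [integral_finsetSum _ fun j _ => i j]
  have e : (magneticForm h hA).form u v =
      ∑ j, inner ℂ (derivConjA h hA j v) (derivA h hA j u) := rfl
  simp only [e, L2.inner_def, RCLike.inner_apply]

/-- The imaginary part of `A` is form-bounded, with relative bound less than one, with respect to
`(-i h ∇ - Re A)²`. -/
def ImFormBounded (h : ℝ) (A : Space d → EuclideanSpace ℂ (Fin d)) : Prop :=
  ∃ a b : ℝ, 0 < a ∧ a < 1 ∧ 0 ≤ b ∧ ∀ u : Space d → ℂ, IsTestFunction u →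
    ∫ x, ∑ j, ‖imComp A j x * u x‖ ^ 2 ≤
      a * (∫ x, ∑ j, ‖-Complex.I * h * partialDeriv j u x - reComp A j x * u x‖ ^ 2) +
        b * ∫ x, ‖u x‖ ^ 2

end Magnetic

/-!
Write `D = -i h ∇ - Re A` and `B = Im A`. On the form domain
`Q(u, u) = ‖D u‖² - ‖B u‖² - 2 i Re ⟨D u, B u⟩`, so everything follows from the bound
`‖B u‖² ≤ a ‖D u‖² + b ‖u‖²` with `a < 1`: it makes `Re Q + α` equivalent to
`‖D u‖² + ‖B u‖² + ‖u‖²` and dominates `Im Q`, which gives sectoriality; closedness then reduces to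
the closedness of the distributional operator `D` and of multiplication by `B`.

The bound is assumed for test functions only. It extends to the form domain
(`Magnetic.imSq_le`) by Fatou's lemma, because test functions are dense in the magnetic Sobolev space
`{u ∈ L² : D u ∈ L²}` (`Magnetic.mem_closure_testGraph`). As `Re A` is merely in `L²_loc`, mollifying
`u` need not give functions close to `u` in that space unless `u` is bounded. So `u` is cut off to
have compact support, truncated to be bounded, and mollified. The truncation
`u ↦ u / (1 + ε² |u|²)` commutes with rotations of `ℂ`, so that the real potential drops out of the
formula for `D` of the truncated function (`Magnetic.IsWeakMagneticDeriv.truncate`); the weak chain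
rule behind it (`Magnetic.HasWeakPartial.comp`) is proved by mollification in `L¹`.

The statement about the operator is Kato's first representation theorem
(`SesqForm.isMSectorial_operator`). Its proof applies the Lax–Milgram lemma to `Q + α + z` on the
form domain with its graph norm, realised as a closed subspace of a Hilbert sum.
-/

/-! ### Sectors -/

/-- The region `|Im z| ≤ M Re z` is contained in the sector with vertex `0` and semi-angle
`arctan M`. -/
theorem abs_arg_le_arctan {z : ℂ} {M : ℝ} (hre : 0 ≤ z.re) (hM : 0 ≤ M)
    (hz : |z.im| ≤ M * z.re) : |z.arg| ≤ Real.arctan M := by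
  rcases hre.eq_or_lt with h0 | hpos
  · have him : z.im = 0 := by simpa [← h0] using hz
    have : z = 0 := Complex.ext h0.symm him
    simpa [this] using hM
  have harg : |z.arg| < Real.pi / 2 := Complex.abs_arg_lt_pi_div_two_iff.2 (Or.inl hpos)
  rw [abs_lt] at harg
  have htan : z.arg = Real.arctan (z.im / z.re) := by
    rw [← Complex.tan_arg, Real.arctan_tan harg.1 harg.2]
  rw [abs_le] at hz
  rw [htan, abs_le, ← Real.arctan_neg]
  refine ⟨Real.arctan_mono ?_, Real.arctan_mono ?_⟩
  · rw [le_div_iff₀ hpos]; linarith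
  · rw [div_le_iff₀ hpos]; linarith

/-! ### The representation theorem for closed sectorial forms -/

namespace SesqForm

variable {H F : Type*} [NormedAddCommGroup H] [InnerProductSpace ℂ H]
  [NormedAddCommGroup F] [InnerProductSpace ℂ F]

/-- The range of `u ↦ (u, N u, P u)` is a closed subspace of `H × F × F` if the form
`(u, v) ↦ ⟨N u, P v⟩` is closed and controls `‖N u‖` and `‖P u‖`. -/
theorem isClosed_range_of_coercive (t : SesqForm H) (ht : t.IsClosed)
    (N P : t.domain →ₗ[ℂ] F) (hform : ∀ u v, t.form u v = inner ℂ (P v) (N u))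
    {c α : ℝ} (hc : 0 < c)
    (hcoer : ∀ u : t.domain, c * (‖N u‖ ^ 2 + ‖P u‖ ^ 2 + ‖(u : H)‖ ^ 2) ≤
      (t.form u u).re + α * ‖(u : H)‖ ^ 2) :
    _root_.IsClosed (Set.range fun u : t.domain => ((u : H), N u, P u)) := by
  refine isClosed_of_closure_subset fun e he => ?_
  obtain ⟨s, hs, hlim⟩ := mem_closure_iff_seq_limit.1 he
  choose u hu using hs
  obtain rfl : (fun n => ((u n : H), N (u n), P (u n))) = s := funext hu
  have h1 : Tendsto (fun n => (u n : H)) atTop (𝓝 e.1) := (continuous_fst.tendsto _).comp hlim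
  have h2 : Tendsto (fun n => N (u n)) atTop (𝓝 e.2.1) :=
    ((continuous_fst.comp continuous_snd).tendsto _).comp hlim
  have h3 : Tendsto (fun n => P (u n)) atTop (𝓝 e.2.2) :=
    ((continuous_snd.comp continuous_snd).tendsto _).comp hlim
  have hcauchy : Tendsto (fun p : ℕ × ℕ => t.form (u p.1 - u p.2) (u p.1 - u p.2)) atTop
      (𝓝 0) := by
    simp only [hform, map_sub N, map_sub P]
    have hN : Tendsto (fun p : ℕ × ℕ => N (u p.1) - N (u p.2)) atTop (𝓝 0) := by
      rw [← sub_self e.2.1, ← prod_atTop_atTop_eq]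
      exact (h2.comp tendsto_fst).sub (h2.comp tendsto_snd)
    have hP : Tendsto (fun p : ℕ × ℕ => P (u p.1) - P (u p.2)) atTop (𝓝 0) := by
      rw [← sub_self e.2.2, ← prod_atTop_atTop_eq]
      exact (h3.comp tendsto_fst).sub (h3.comp tendsto_snd)
    simpa only [inner_zero_right] using Tendsto.inner (𝕜 := ℂ) hP hN
  obtain ⟨hx, hform0⟩ := ht u e.1 h1 hcauchy
  have hnorm : Tendsto (fun n => ‖((u n - ⟨e.1, hx⟩ : t.domain) : H)‖ ^ 2) atTop (𝓝 0) := by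
    have : Tendsto (fun n => (u n : H) - e.1) atTop (𝓝 0) := by
      simpa using h1.sub_const e.1
    simpa using (this.norm.pow 2)
  have hzero : Tendsto (fun n => ‖N (u n - ⟨e.1, hx⟩)‖ ^ 2 + ‖P (u n - ⟨e.1, hx⟩)‖ ^ 2 +
      ‖((u n - ⟨e.1, hx⟩ : t.domain) : H)‖ ^ 2) atTop (𝓝 0) := by
    have hre := (((Complex.continuous_re.tendsto _).comp hform0).add
      (hnorm.const_mul α)).const_mul c⁻¹
    simp only [Complex.zero_re, mul_zero, add_zero] at hre
    refine squeeze_zero (fun n => by positivity) (fun n => ?_) hre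
    rw [le_inv_mul_iff₀ hc]
    exact hcoer _
  refine ⟨⟨e.1, hx⟩, ?_⟩
  have hlimit {L : t.domain →ₗ[ℂ] F} {y : F} (hL : Tendsto (fun n => L (u n)) atTop (𝓝 y))
      (hle : ∀ v : t.domain, ‖L v‖ ^ 2 ≤ ‖N v‖ ^ 2 + ‖P v‖ ^ 2 + ‖(v : H)‖ ^ 2) :
      L ⟨e.1, hx⟩ = y := by
    have hsq : Tendsto (fun n => ‖L (u n - ⟨e.1, hx⟩)‖ ^ 2) atTop (𝓝 0) :=
      squeeze_zero (fun n => by positivity) (fun n => hle _) hzero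
    have hn : Tendsto (fun n => ‖L (u n - ⟨e.1, hx⟩)‖) atTop (𝓝 0) := by
      simpa using hsq.sqrt
    simp only [map_sub] at hn
    exact tendsto_nhds_unique (tendsto_iff_norm_sub_tendsto_zero.2 hn) hL
  refine Prod.ext rfl (Prod.ext (hlimit h2 fun v => ?_) (hlimit h3 fun v => ?_))
  · nlinarith [sq_nonneg ‖P v‖, sq_nonneg ‖(v : H)‖]
  · nlinarith [sq_nonneg ‖N v‖, sq_nonneg ‖(v : H)‖]

theorem re_mul_inner_self (ζ : ℂ) (u : H) : (ζ * inner ℂ u u).re = ζ.re * ‖u‖ ^ 2 := by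
  rw [inner_self_eq_norm_sq_to_K, ← Complex.re_mul_ofReal]
  norm_cast

/-- Lax–Milgram: let the form domain be embedded by `ι` as a closed subspace of a Hilbert space on
which the form is given by bounded operators. If `t + ζ` is coercive there, the equation
`t (u, v) + ζ ⟨u, v⟩ = ⟨f, v⟩` for all `v` is solved by `u = R f` with a bounded operator `R`. -/
theorem exists_form_inverse {E : Type*} [NormedAddCommGroup E] [InnerProductSpace ℂ E]
    [CompleteSpace E] [CompleteSpace H] [CompleteSpace F] (t : SesqForm H)
    (ι : t.domain →ₗ[ℂ] E) (hclosed : _root_.IsClosed (Set.range ι)) (p : E →L[ℂ] H)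
    (hp : ∀ u, p (ι u) = u) (n q : E →L[ℂ] F)
    (hform : ∀ u v, t.form u v = inner ℂ (q (ι v)) (n (ι u))) {c : ℝ} {ζ : ℂ} (hc : 0 < c)
    (hcoer : ∀ u : t.domain, c * ‖ι u‖ ^ 2 ≤ (t.form u u).re + ζ.re * ‖(u : H)‖ ^ 2) :
    ∃ R : H →L[ℂ] H, ∀ f : H, ∃ hf : R f ∈ t.domain, ∀ v : t.domain,
      t.form ⟨R f, hf⟩ v + ζ * inner ℂ (v : H) (R f) = inner ℂ (v : H) f := by
  let K := LinearMap.range ι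
  have hK : _root_.IsClosed (K : Set E) := by
    simpa only [K, LinearMap.coe_range] using hclosed
  have : CompleteSpace K := hK.completeSpace_coe
  let pK : K →L[ℂ] H := p ∘L K.subtypeL
  let nK : K →L[ℂ] F := n ∘L K.subtypeL
  let qK : K →L[ℂ] F := q ∘L K.subtypeL
  let T : K →L[ℂ] K := qK.adjoint ∘L nK + ζ • (pK.adjoint ∘L pK)
  have hT (x y : K) : inner ℂ y (T x) = inner ℂ (qK y) (nK x) + ζ * inner ℂ (pK y) (pK x) := by
    simp only [T, add_apply, smul_apply,
      ContinuousLinearMap.comp_apply, inner_add_right, inner_smul_right,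
      ContinuousLinearMap.adjoint_inner_right]
  have hunit : IsUnit T := by
    refine ContinuousLinearMap.isUnit_of_forall_le_norm_inner_map T (c := ⟨c, hc.le⟩)
      (by exact_mod_cast hc) ?_
    rintro ⟨_, ⟨u, rfl⟩⟩
    rw [norm_inner_symm, hT]
    refine le_trans ?_ (Complex.re_le_norm _)
    change ‖ι u‖ ^ 2 * c ≤ (inner ℂ (q (ι u)) (n (ι u)) + ζ * inner ℂ (p (ι u)) (p (ι u))).re
    rw [Complex.add_re, re_mul_inner_self, hp, ← hform, mul_comm]
    exact hcoer u
  obtain ⟨U, hU⟩ := hunit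
  have hinv (y : K) : T ((↑U⁻¹ : K →L[ℂ] K) y) = y := by
    rw [← hU, ← mul_apply_eq_comp, Units.mul_inv, one_apply_eq_self]
  refine ⟨pK ∘L (↑U⁻¹ : K →L[ℂ] K) ∘L pK.adjoint, fun f => ?_⟩
  obtain ⟨⟨_, ⟨u, rfl⟩⟩, hx⟩ : ∃ x : K, x = (↑U⁻¹ : K →L[ℂ] K) (pK.adjoint f) := ⟨_, rfl⟩
  have hRf : (pK ∘L (↑U⁻¹ : K →L[ℂ] K) ∘L pK.adjoint) f = u := by
    simp only [ContinuousLinearMap.comp_apply, ← hx]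
    exact hp u
  refine ⟨hRf ▸ u.2, fun v => ?_⟩
  have hsub : (⟨(pK ∘L (↑U⁻¹ : K →L[ℂ] K) ∘L pK.adjoint) f, hRf ▸ u.2⟩ : t.domain) = u :=
    Subtype.ext hRf
  rw [hsub, hRf, hform]
  have h1 := hT ⟨ι u, ⟨u, rfl⟩⟩ ⟨ι v, ⟨v, rfl⟩⟩
  rw [hx, hinv, ContinuousLinearMap.adjoint_inner_right, ← hx] at h1
  change inner ℂ (p (ι v)) f = inner ℂ (q (ι v)) (n (ι u)) +
    ζ * inner ℂ (p (ι v)) (p (ι u)) at h1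
  rw [hp, hp] at h1
  exact h1.symm

/-- Solvability of `t (u, v) + ζ ⟨u, v⟩ = ⟨f, v⟩` for a form `t (u, v) = ⟨N u, P v⟩` such that
`t + ζ` dominates the graph norm of `u ↦ (N u, P u)`. -/
theorem exists_form_inverse_of_closed [CompleteSpace H] [CompleteSpace F] (t : SesqForm H)
    (N P : t.domain →ₗ[ℂ] F) (hform : ∀ u v, t.form u v = inner ℂ (P v) (N u))
    (hclosed : _root_.IsClosed (Set.range fun u : t.domain => ((u : H), N u, P u)))
    {c : ℝ} {ζ : ℂ} (hc : 0 < c)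
    (hcoer : ∀ u : t.domain, c * (‖N u‖ ^ 2 + ‖P u‖ ^ 2 + ‖(u : H)‖ ^ 2) ≤
      (t.form u u).re + ζ.re * ‖(u : H)‖ ^ 2) :
    ∃ R : H →L[ℂ] H, ∀ f : H, ∃ hf : R f ∈ t.domain, ∀ v : t.domain,
      t.form ⟨R f, hf⟩ v + ζ * inner ℂ (v : H) (R f) = inner ℂ (v : H) f := by
  let ι : t.domain →ₗ[ℂ] WithLp 2 (H × WithLp 2 (F × F)) :=
    (WithLp.linearEquiv 2 ℂ (H × WithLp 2 (F × F))).symm.toLinearMap ∘ₗ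
      t.domain.subtype.prod ((WithLp.linearEquiv 2 ℂ (F × F)).symm.toLinearMap ∘ₗ N.prod P)
  have hnorm (u : t.domain) : ‖ι u‖ ^ 2 = ‖(u : H)‖ ^ 2 + (‖N u‖ ^ 2 + ‖P u‖ ^ 2) := by
    rw [WithLp.prod_norm_sq_eq_of_L2, WithLp.prod_norm_sq_eq_of_L2]
    rfl
  have hι : _root_.IsClosed (Set.range ι) := by
    let g : WithLp 2 (H × WithLp 2 (F × F)) → H × F × F :=
      fun e => (e.fst, e.snd.fst, e.snd.snd)
    have hg : Continuous g := by
      have h1 := (WithLp.fstL 2 ℂ H (WithLp 2 (F × F))).continuous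
      have h2 := (WithLp.sndL 2 ℂ H (WithLp 2 (F × F))).continuous
      exact h1.prodMk (((WithLp.fstL 2 ℂ F F).continuous.comp h2).prodMk
        ((WithLp.sndL 2 ℂ F F).continuous.comp h2))
    have heq : Set.range ι = g ⁻¹' (Set.range fun u : t.domain => ((u : H), N u, P u)) := by
      ext e
      constructor
      · rintro ⟨u, rfl⟩
        exact ⟨u, rfl⟩
      · rintro ⟨u, hu⟩
        refine ⟨u, ?_⟩
        simp only [g, Prod.mk.injEq] at hu
        exact WithLp.ofLp_injective 2 (Prod.ext hu.1 (WithLp.ofLp_injective 2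
          (Prod.ext hu.2.1 hu.2.2)))
    rw [heq]
    exact hclosed.preimage hg
  refine t.exists_form_inverse ι hι (WithLp.fstL 2 ℂ H (WithLp 2 (F × F))) (fun u => rfl)
    (WithLp.fstL 2 ℂ F F ∘L WithLp.sndL 2 ℂ H (WithLp 2 (F × F)))
    (WithLp.sndL 2 ℂ F F ∘L WithLp.sndL 2 ℂ H (WithLp 2 (F × F)))
    (fun u v => hform u v) hc fun u => ?_
  rw [hnorm, add_comm]
  exact hcoer u

theorem mem_operator_domain {t : SesqForm H} (ht : t.IsDenselyDefined) {u f : H}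
    (hu : u ∈ t.domain) (huf : ∀ v : t.domain, t.form ⟨u, hu⟩ v = inner ℂ (v : H) f) :
    ∃ h : u ∈ t.operator.domain, t.operator ⟨u, h⟩ = f := by
  have h1 : (u, f) ∈ t.operator.graph := by
    rw [t.graph_operator ht]
    exact ⟨hu, huf⟩
  obtain ⟨y, hy, hyf⟩ := (LinearPMap.mem_graph_iff _).1 h1
  simp only at hy hyf
  subst hy
  exact ⟨y.2, hyf⟩

theorem form_eq_inner_operator {t : SesqForm H} (ht : t.IsDenselyDefined) (u : t.operator.domain) :
    ∃ hu : (u : H) ∈ t.domain, ∀ v : t.domain,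
      t.form ⟨u, hu⟩ v = inner ℂ (v : H) (t.operator u) := by
  have := LinearPMap.mem_graph t.operator u
  rw [t.graph_operator ht] at this
  exact this

theorem isSectorial_operator {t : SesqForm H} (ht : t.IsDenselyDefined) (hs : t.IsSectorial) :
    t.operator.IsSectorial := by
  obtain ⟨γ, θ, h0, hθ, hsub⟩ := hs
  refine ⟨γ, θ, h0, hθ, ?_⟩
  rintro z ⟨u, hu, rfl⟩
  obtain ⟨hu', huv⟩ := form_eq_inner_operator ht u
  exact hsub ⟨⟨u, hu'⟩, hu, huv ⟨u, hu'⟩⟩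

/-- Kato's first representation theorem, for a form given as `t (u, v) = ⟨N u, P v⟩`: the operator
associated with a densely defined, closed and sectorial form is m-sectorial. The coercivity
estimate says that `Re t + α` dominates the norm of the form domain. -/
theorem isMSectorial_operator [CompleteSpace H] [CompleteSpace F] (t : SesqForm H)
    (hd : t.IsDenselyDefined) (ht : t.IsClosed) (hs : t.IsSectorial)
    (N P : t.domain →ₗ[ℂ] F) (hform : ∀ u v, t.form u v = inner ℂ (P v) (N u))
    {c α : ℝ} (hc : 0 < c)
    (hcoer : ∀ u : t.domain, c * (‖N u‖ ^ 2 + ‖P u‖ ^ 2 + ‖(u : H)‖ ^ 2) ≤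
      (t.form u u).re + α * ‖(u : H)‖ ^ 2) :
    t.operator.IsMSectorial := by
  have hclosed := t.isClosed_range_of_coercive ht N P hform hc hcoer
  have hnonneg (u : t.domain) : c * ‖(u : H)‖ ^ 2 ≤ (t.form u u).re + α * ‖(u : H)‖ ^ 2 := by
    refine le_trans ?_ (hcoer u)
    have : 0 ≤ ‖N u‖ ^ 2 + ‖P u‖ ^ 2 := by positivity
    nlinarith
  have hlower (u : t.operator.domain) (ζ : ℂ) : (c + (ζ.re - α)) * ‖(u : H)‖ ^ 2 ≤
      ‖t.operator u + ζ • (u : H)‖ * ‖(u : H)‖ := by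
    obtain ⟨hu, huv⟩ := form_eq_inner_operator hd u
    have h1 := hnonneg ⟨u, hu⟩
    rw [huv] at h1
    have h2 : (inner ℂ (u : H) (t.operator u + ζ • (u : H))).re =
        (inner ℂ (u : H) (t.operator u)).re + ζ.re * ‖(u : H)‖ ^ 2 := by
      rw [inner_add_right, inner_smul_right, Complex.add_re, re_mul_inner_self]
    have h3 := (Complex.re_le_norm _).trans
      (norm_inner_le_norm (𝕜 := ℂ) (u : H) (t.operator u + ζ • (u : H)))
    rw [h2, mul_comm] at h3
    simp only at h1
    nlinarith
  have hres (ζ : ℂ) (hζ : α ≤ ζ.re) : ∃ R : H →L[ℂ] H, t.operator.IsInverseOfAdd ζ R := by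
    obtain ⟨R, hR⟩ := t.exists_form_inverse_of_closed N P hform hclosed (ζ := ζ) hc fun u =>
      (hcoer u).trans (by gcongr)
    have hright (f : H) : ∃ hf : R f ∈ t.operator.domain,
        t.operator ⟨R f, hf⟩ + ζ • R f = f := by
      obtain ⟨hf, hv⟩ := hR f
      obtain ⟨h1, h2⟩ := mem_operator_domain hd (f := f - ζ • R f) hf fun v => by
        rw [inner_sub_right, inner_smul_right, ← hv v]; ring
      exact ⟨h1, by rw [h2]; abel⟩
    refine ⟨R, hright, fun u => ?_⟩
    obtain ⟨hf, hfeq⟩ := hright (t.operator u + ζ • (u : H))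
    set w : t.operator.domain := ⟨R (t.operator u + ζ • (u : H)), hf⟩ with hw
    have h0 : t.operator (w - u) + ζ • ((w - u : t.operator.domain) : H) = 0 := by
      rw [LinearPMap.map_sub, Submodule.coe_sub, smul_sub]
      have : t.operator w + ζ • (w : H) = t.operator u + ζ • (u : H) := hfeq
      rw [sub_add_sub_comm, this, sub_self]
    have h1 := hlower (w - u) ζ
    rw [h0, norm_zero, zero_mul] at h1
    have h2 : ‖((w - u : t.operator.domain) : H)‖ ^ 2 = 0 :=
      le_antisymm (nonpos_of_mul_nonpos_right h1 (by linarith)) (sq_nonneg _)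
    have h3 : ((w - u : t.operator.domain) : H) = 0 := by simpa using h2
    rw [Submodule.coe_sub, sub_eq_zero] at h3
    exact h3
  obtain ⟨R, hR⟩ := hres α (by simp)
  refine ⟨?_, ?_, isSectorial_operator hd hs, α, fun z hz => ?_⟩
  · -- A vector orthogonal to the range of the resolvent is orthogonal to its own image.
    rw [Submodule.dense_iff_topologicalClosure_eq_top, Submodule.topologicalClosure_eq_top_iff,
      Submodule.eq_bot_iff]
    intro g hg
    obtain ⟨hf, hfeq⟩ := hR.1 g
    obtain ⟨hu, huv⟩ := form_eq_inner_operator hd ⟨R g, hf⟩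
    have h1 : inner ℂ (R g) g = (0 : ℂ) := (Submodule.mem_orthogonal _ _).1 hg _ hf
    have h2 := hnonneg ⟨R g, hu⟩
    rw [huv] at h2
    have h3 : (inner ℂ (R g) (t.operator ⟨R g, hf⟩)).re + α * ‖R g‖ ^ 2 = 0 := by
      have h4 : inner ℂ (R g) (t.operator ⟨R g, hf⟩ + (α : ℂ) • R g) = (0 : ℂ) := by
        rw [hfeq, h1]
      have h5 := congrArg Complex.re h4
      rwa [inner_add_right, inner_smul_right, Complex.add_re, re_mul_inner_self,
        Complex.ofReal_re, Complex.zero_re] at h5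
    have h4 : ‖R g‖ ^ 2 = 0 := by
      refine le_antisymm ?_ (sq_nonneg _)
      refine nonpos_of_mul_nonpos_right (a := c) ?_ hc
      simp only at h2
      linarith
    have h5 : R g = 0 := by simpa using h4
    have h6 : (⟨R g, hf⟩ : t.operator.domain) = 0 := Subtype.ext h5
    rw [h6, h5, LinearPMap.map_zero] at hfeq
    simpa using hfeq.symm
  · have hgraph : (t.operator.graph : Set (H × H)) =
        {p : H × H | R (p.2 + (α : ℂ) • p.1) = p.1} := by
      ext ⟨u, f⟩
      simp only [SetLike.mem_coe, LinearPMap.mem_graph_iff, Set.mem_ofPred_eq]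
      constructor
      · rintro ⟨y, rfl, rfl⟩
        exact hR.2 y
      · intro h
        obtain ⟨hf, hfeq⟩ := hR.1 (f + (α : ℂ) • u)
        refine ⟨⟨_, hf⟩, h, ?_⟩
        rw [eq_sub_of_add_eq hfeq, h, add_sub_cancel_right]
    rw [LinearPMap.IsClosed, hgraph]
    exact isClosed_eq (by fun_prop) (by fun_prop)
  · obtain ⟨S, hS⟩ := hres (α + z) (by simpa using hz.le)
    refine ⟨S, hS, ContinuousLinearMap.opNorm_le_bound _ (by positivity) fun f => ?_⟩
    obtain ⟨hf, hfeq⟩ := hS.1 f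
    have h1 := hlower ⟨S f, hf⟩ (α + z)
    simp only [hfeq, Complex.add_re, Complex.ofReal_re] at h1
    rw [le_inv_mul_iff₀ hz]
    rcases (norm_nonneg (S f)).eq_or_lt with h0 | hpos
    · rw [← h0, mul_zero]; exact norm_nonneg _
    · refine le_of_mul_le_mul_right ?_ hpos
      nlinarith [mul_pos hc (pow_pos hpos 2)]

end SesqForm

/-! ### Convergence in `L^p` -/

section Convergence

open scoped ENNReal
open ContinuousLinearMap (lsmul)

/-- Dominated convergence in `L^p`. -/
theorem tendsto_eLpNorm_of_dominated {α E : Type*} [MeasurableSpace α] {μ : Measure α}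
    [NormedAddCommGroup E] {p : ℝ≥0∞} (hp1 : 1 ≤ p) (hp : p ≠ ⊤) {f : ℕ → α → E} {g : α → E}
    {G : α → ℝ} (hf : ∀ n, AEStronglyMeasurable (f n) μ) (hG : MemLp G p μ)
    (hbound : ∀ n, ∀ᵐ x ∂μ, ‖f n x‖ ≤ G x)
    (hlim : ∀ᵐ x ∂μ, Tendsto (fun n => f n x) atTop (𝓝 (g x))) :
    Tendsto (fun n => eLpNorm (f n - g) p μ) atTop (𝓝 0) := by
  have hp0 : p ≠ 0 := (one_pos.trans_le hp1).ne'
  have hpos : 0 < p.toReal := ENNReal.toReal_pos hp0 hp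
  have hgm : AEStronglyMeasurable g μ := aestronglyMeasurable_of_tendsto_ae _ hf hlim
  have hgG : ∀ᵐ x ∂μ, ‖g x‖ ≤ G x := by
    filter_upwards [hlim, ae_all_iff.2 hbound] with x hx hx'
    exact le_of_tendsto' hx.norm hx'
  have hint : Tendsto (fun n => ∫⁻ x, ‖(f n - g) x‖ₑ ^ p.toReal ∂μ) atTop (𝓝 0) := by
    rw [← lintegral_zero (μ := μ)]
    refine tendsto_lintegral_of_dominated_convergence' (fun x => ‖2 * G x‖ₑ ^ p.toReal)
      (fun n => ((hf n).sub hgm).enorm.pow_const _) (fun n => ?_) ?_ ?_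
    · filter_upwards [hbound n, hgG] with x h1 h2
      refine ENNReal.rpow_le_rpow ?_ hpos.le
      refine enorm_le_iff_norm_le.2 ((norm_sub_le _ _).trans ?_)
      exact (by linarith : ‖f n x‖ + ‖g x‖ ≤ 2 * G x).trans (Real.le_norm_self _)
    · exact ((eLpNorm_lt_top_iff_lintegral_rpow_enorm_lt_top hp0 hp).1
        (hG.const_mul 2).eLpNorm_lt_top).ne
    · filter_upwards [hlim] with x hx
      have h1 : Tendsto (fun n => ‖(f n - g) x‖ₑ) atTop (𝓝 0) := by
        have : Tendsto (fun n => f n x - g x) atTop (𝓝 0) := by simpa using hx.sub_const (g x)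
        simpa using this.enorm
      have h2 := ((ENNReal.continuous_rpow_const (y := p.toReal)).tendsto 0).comp h1
      rwa [ENNReal.zero_rpow_of_pos hpos] at h2
  simp only [eLpNorm_eq_lintegral_rpow_enorm_toReal hp0 hp]
  have h3 := ((ENNReal.continuous_rpow_const (y := 1 / p.toReal)).tendsto 0).comp hint
  rwa [ENNReal.zero_rpow_of_pos (by positivity)] at h3

variable {G E : Type*} [NormedAddCommGroup G] [NormedSpace ℝ G] [FiniteDimensional ℝ G]
  [MeasurableSpace G] [BorelSpace G] {μ : Measure G} [μ.IsAddHaarMeasure]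
  [NormedAddCommGroup E]

/-- Translations are continuous in `L^p`. -/
theorem tendsto_eLpNorm_translate {p : ℝ≥0∞} (hp1 : 1 ≤ p) (hp : p ≠ ⊤) {f : G → E}
    (hf : MemLp f p μ) :
    Tendsto (fun y => eLpNorm (fun x => f (x - y) - f x) p μ) (𝓝 0) (𝓝 0) := by
  have : Fact (1 ≤ p) := ⟨hp1⟩
  let g : C(G, C(G, G)) := (ContinuousMap.mk (fun a : G × G => a.2 - a.1) (by fun_prop)).curry
  have hgm (y : G) : MeasurePreserving (g y) μ μ := measurePreserving_sub_right μ y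
  have h1 := (tendsto_const_nhds (x := hf.toLp f) (f := 𝓝 (0 : G))).compMeasurePreservingLp
    (g.continuous.tendsto 0) hgm (hgm 0) hp
  rw [Lp.tendsto_Lp_iff_tendsto_eLpNorm'] at h1
  refine h1.congr fun y => eLpNorm_congr_ae ?_
  have h2 (y : G) : (Lp.compMeasurePreserving (g y) (hgm y) (hf.toLp f) : G → E) =ᵐ[μ]
      fun x => f (x - y) :=
    (Lp.coeFn_compMeasurePreserving _ (hgm y)).trans
      ((hgm y).quasiMeasurePreserving.ae_eq_comp hf.coeFn_toLp)
  filter_upwards [h2 y, h2 0] with x hx hx0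
  simp only [Pi.sub_apply, hx, hx0, sub_zero]

variable [NormedSpace ℝ E] [CompleteSpace E] [HasContDiffBump G]

/-- The distance in `L^p` between `f` and its mean against a probability density supported in a
small ball is at most the largest distance between `f` and its translates by vectors in the ball:
this is Jensen's inequality. -/
theorem eLpNorm_convolution_sub_le {p : ℝ≥0∞} (hp1 : 1 ≤ p) (hp : p ≠ ⊤) {f : G → E}
    (hf : MemLp f p μ) (φ : ContDiffBump (0 : G)) {ε : ℝ≥0∞}
    (hε : ∀ y ∈ Metric.ball (0 : G) φ.rOut, eLpNorm (fun x => f (x - y) - f x) p μ ≤ ε) :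
    eLpNorm (convolution (φ.normed μ) f (lsmul ℝ ℝ) μ - f) p μ ≤ ε := by
  have hp0 : p ≠ 0 := (one_pos.trans_le hp1).ne'
  have hpos : 0 < p.toReal := ENNReal.toReal_pos hp0 hp
  have hp1' : 1 ≤ p.toReal := by
    simpa using ENNReal.toReal_mono hp hp1
  wlog hfm : StronglyMeasurable f generalizing f
  · have hae := hf.1.ae_eq_mk
    have h1 := this (hf.ae_eq hae) (fun y hy => ?_) hf.1.stronglyMeasurable_mk
    · rw [← convolution_congr (lsmul ℝ ℝ) (EventuallyEq.refl (ae μ) (φ.normed μ)) hae] at h1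
      refine (eLpNorm_congr_ae ?_).trans_le h1
      filter_upwards [hae] with x hx
      simp only [Pi.sub_apply, hx]
    · refine (eLpNorm_congr_ae ?_).trans_le (hε y hy)
      filter_upwards [hae, (measurePreserving_sub_right μ y).quasiMeasurePreserving.ae_eq_comp
        hae] with x hx hx'
      simp only [Function.comp_apply] at hx'
      rw [hx, hx']
  set ρ : G → ℝ := φ.normed μ with hρ
  have hρc : Continuous ρ := φ.continuous_normed
  have hρm : Measurable fun y => ‖ρ y‖ₑ := hρc.measurable.enorm
  let ν : Measure G := μ.withDensity fun y => ‖ρ y‖ₑ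
  have hν : IsProbabilityMeasure ν := by
    refine ⟨?_⟩
    rw [withDensity_apply _ MeasurableSet.univ, Measure.restrict_univ]
    have h1 : (∫⁻ y, ‖ρ y‖ₑ ∂μ) = ENNReal.ofReal (∫ y, ρ y ∂μ) := by
      rw [ofReal_integral_eq_lintegral_ofReal φ.integrable_normed
        (ae_of_all _ fun y => φ.nonneg_normed y)]
      exact lintegral_congr fun y => Real.enorm_of_nonneg (φ.nonneg_normed y)
    rw [h1, hρ, φ.integral_normed, ENNReal.ofReal_one]
  have hloc : LocallyIntegrable f μ := hf.locallyIntegrable hp1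
  have hmeas : Measurable fun q : G × G => ‖f (q.1 - q.2) - f q.1‖ₑ :=
    ((hfm.comp_measurable (measurable_fst.sub measurable_snd)).sub
      (hfm.comp_measurable measurable_fst)).enorm
  have hpoint (x : G) : ‖(convolution ρ f (lsmul ℝ ℝ) μ - f) x‖ₑ ^ p.toReal ≤
      ∫⁻ y, ‖f (x - y) - f x‖ₑ ^ p.toReal ∂ν := by
    have h1 : (convolution ρ f (lsmul ℝ ℝ) μ - f) x = ∫ y, ρ y • (f (x - y) - f x) ∂μ := by
      have hi : Integrable (fun y => ρ y • f (x - y)) μ :=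
        φ.hasCompactSupport_normed.convolutionExists_left (lsmul ℝ ℝ) hρc hloc x
      simp only [smul_sub]
      rw [integral_sub hi (φ.integrable_normed.smul_const _), integral_smul_const,
        φ.integral_normed, one_smul]
      rfl
    have h2 : ‖(convolution ρ f (lsmul ℝ ℝ) μ - f) x‖ₑ ≤
        eLpNorm' (fun y => f (x - y) - f x) 1 ν := by
      rw [h1, eLpNorm'_eq_lintegral_enorm, div_one, ENNReal.rpow_one]
      simp only [ENNReal.rpow_one]
      have hm : Measurable fun y => ‖f (x - y) - f x‖ₑ := hmeas.comp measurable_prodMk_left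
      rw [lintegral_withDensity_eq_lintegral_mul _ hρm hm]
      refine (enorm_integral_le_lintegral_enorm _).trans_eq (lintegral_congr fun y => ?_)
      rw [enorm_smul]
      rfl
    have h3 := h2.trans (eLpNorm'_le_eLpNorm'_of_exponent_le one_pos hp1' ν
      ((hfm.comp_measurable (measurable_const.sub measurable_id)).sub
        stronglyMeasurable_const).aestronglyMeasurable)
    refine (ENNReal.rpow_le_rpow h3 hpos.le).trans_eq ?_
    rw [eLpNorm'_eq_lintegral_enorm, ← ENNReal.rpow_mul, one_div,
      inv_mul_cancel₀ hpos.ne', ENNReal.rpow_one]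
  rw [eLpNorm_eq_lintegral_rpow_enorm_toReal hp0 hp, one_div, ENNReal.rpow_inv_le_iff hpos]
  calc ∫⁻ x, ‖(convolution ρ f (lsmul ℝ ℝ) μ - f) x‖ₑ ^ p.toReal ∂μ
      ≤ ∫⁻ x, ∫⁻ y, ‖f (x - y) - f x‖ₑ ^ p.toReal ∂ν ∂μ := lintegral_mono hpoint
    _ = ∫⁻ y, ∫⁻ x, ‖f (x - y) - f x‖ₑ ^ p.toReal ∂μ ∂ν :=
        lintegral_lintegral_swap (hmeas.pow_const _).aemeasurable
    _ ≤ ∫⁻ _, ε ^ p.toReal ∂ν := by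
        have hsupp : ∀ᵐ y ∂ν, y ∈ Metric.ball (0 : G) φ.rOut := by
          rw [ae_withDensity_iff hρm]
          refine ae_of_all _ fun y hy => ?_
          rw [← φ.support_normed_eq (μ := μ)]
          simpa using hy
        refine lintegral_mono_ae ?_
        filter_upwards [hsupp] with y hy
        have h1 := hε y hy
        rwa [eLpNorm_eq_lintegral_rpow_enorm_toReal hp0 hp, one_div,
          ENNReal.rpow_inv_le_iff hpos] at h1
    _ = ε ^ p.toReal := by simp

/-- Mollifications of an `L^p` function converge to it in `L^p`. -/
theorem tendsto_eLpNorm_convolution_sub {p : ℝ≥0∞} (hp1 : 1 ≤ p) (hp : p ≠ ⊤) {f : G → E}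
    (hf : MemLp f p μ) {φ : ℕ → ContDiffBump (0 : G)}
    (hφ : Tendsto (fun n => (φ n).rOut) atTop (𝓝 0)) :
    Tendsto (fun n => eLpNorm (convolution ((φ n).normed μ) f (lsmul ℝ ℝ) μ - f) p μ) atTop
      (𝓝 0) := by
  rw [ENNReal.tendsto_nhds_zero]
  intro ε hε
  obtain ⟨r, hr, hball⟩ := Metric.eventually_nhds_iff_ball.1
    (ENNReal.tendsto_nhds_zero.1 (tendsto_eLpNorm_translate hp1 hp hf) ε hε)
  filter_upwards [hφ.eventually_lt_const hr] with n hn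
  exact eLpNorm_convolution_sub_le hp1 hp hf (φ n) fun y hy =>
    hball y (Metric.ball_subset_ball hn.le hy)

end Convergence

/-! ### Weak partial derivatives -/

namespace Magnetic

open ContinuousLinearMap (lsmul)

variable {d : ℕ}

/-- `∂_j u = v` in the sense of distributions. -/
def HasWeakPartial (j : Fin d) (u v : Space d → ℂ) : Prop :=
  ∀ φ : Space d → ℂ, IsTestFunction φ → ∫ x, v x * φ x = -∫ x, u x * partialDeriv j φ x

/-- A sequence of bump functions shrinking to the origin. -/
noncomputable def mollifier (d n : ℕ) : ContDiffBump (0 : Space d) where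
  rIn := (2 * ((n : ℝ) + 1))⁻¹
  rOut := ((n : ℝ) + 1)⁻¹
  rIn_pos := by positivity
  rIn_lt_rOut := by
    have : (0 : ℝ) < n + 1 := by positivity
    gcongr
    linarith

/-- The mollification of `u` at scale `1 / (n + 1)`. -/
noncomputable def mollify (n : ℕ) (u : Space d → ℂ) : Space d → ℂ :=
  convolution ((mollifier d n).normed volume) u (lsmul ℝ ℝ) volume

theorem tendsto_mollifier_rOut : Tendsto (fun n => (mollifier d n).rOut) atTop (𝓝 0) := by
  simpa [mollifier, one_div] using tendsto_one_div_add_atTop_nhds_zero_nat (𝕜 := ℝ)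

theorem tendsto_eLpNorm_mollify {p : ENNReal} (hp1 : 1 ≤ p) (hp : p ≠ ⊤) {u : Space d → ℂ}
    (hu : MemLp u p volume) :
    Tendsto (fun n => eLpNorm (mollify n u - u) p volume) atTop (𝓝 0) :=
  tendsto_eLpNorm_convolution_sub hp1 hp hu tendsto_mollifier_rOut

theorem ae_tendsto_mollify {u : Space d → ℂ} (hu : LocallyIntegrable u volume) :
    ∀ᵐ x, Tendsto (fun n => mollify n u x) atTop (𝓝 (u x)) := by
  refine ContDiffBump.ae_convolution_tendsto_right_of_locallyIntegrable (K := 2)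
    tendsto_mollifier_rOut (Eventually.of_forall fun n => le_of_eq ?_) hu
  simp only [mollifier, mul_inv]
  ring

theorem contDiff_mollify {u : Space d → ℂ} (hu : LocallyIntegrable u volume) (n : ℕ) :
    ContDiff ℝ ∞ (mollify n u) :=
  (mollifier d n).hasCompactSupport_normed.contDiff_convolution_left _
    (mollifier d n).contDiff_normed hu

theorem memLp_mollify {p : ENNReal} (hp1 : 1 ≤ p) (hp : p ≠ ⊤) {u : Space d → ℂ}
    (hu : MemLp u p volume) : ∀ᶠ n in atTop, MemLp (mollify n u) p volume := by
  filter_upwards [(tendsto_eLpNorm_mollify hp1 hp hu).eventually_lt_const ENNReal.zero_lt_top]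
    with n hn
  have h1 : MemLp (mollify n u - u) p volume :=
    ⟨(contDiff_mollify (hu.locallyIntegrable hp1) n).continuous.aestronglyMeasurable.sub hu.1, hn⟩
  simpa using h1.add hu

/-- Mollification commutes with weak derivatives. -/
theorem partialDeriv_mollify {j : Fin d} {u v : Space d → ℂ} (hu : LocallyIntegrable u volume)
    (huv : HasWeakPartial j u v) (n : ℕ) (x : Space d) :
    partialDeriv j (mollify n u) x = mollify n v x := by
  set ρ := (mollifier d n).normed volume with hρ
  have hρs : ContDiff ℝ ∞ ρ := (mollifier d n).contDiff_normed
  have hρc : HasCompactSupport ρ := (mollifier d n).hasCompactSupport_normed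
  have h1 : partialDeriv j (mollify n u) x =
      ∫ y, (fderiv ℝ ρ (x - y) (EuclideanSpace.single j 1)) • u y := by
    have hd := (hρc.hasFDerivAt_convolution_right (lsmul ℝ ℝ).flip hu
      (hρs.of_le (by exact_mod_cast le_top)) x).fderiv
    rw [convolution_flip] at hd
    change fderiv ℝ (mollify n u) x = _ at hd
    rw [partialDeriv, hd, convolution_precompR_apply _ hu (hρc.fderiv ℝ)
      (hρs.continuous_fderiv (by simp))]
    rfl
  have h2 : mollify n v x = ∫ y, v y * (ρ (x - y) : ℂ) := by
    rw [mollify, convolution_lsmul_swap]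
    refine integral_congr_ae (ae_of_all _ fun y => ?_)
    simp only [Complex.real_smul, mul_comm, hρ]
  let φ : Space d → ℂ := fun y => (ρ (x - y) : ℂ)
  have hφ : IsTestFunction φ := by
    refine ⟨Complex.ofRealCLM.contDiff.comp (hρs.comp (contDiff_const.sub contDiff_id)), ?_⟩
    have : HasCompactSupport fun y => ρ (x - y) :=
      hρc.comp_homeomorph (Homeomorph.subLeft x)
    exact this.comp_left (g := Complex.ofReal) rfl
  have hdφ (y : Space d) : partialDeriv j φ y =
      -((fderiv ℝ ρ (x - y) (EuclideanSpace.single j 1) : ℝ) : ℂ) := by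
    have hd : HasFDerivAt φ (Complex.ofRealCLM ∘L (fderiv ℝ ρ (x - y) ∘L
        (-ContinuousLinearMap.id ℝ (Space d)))) y := by
      have e1 : HasFDerivAt (fun y : Space d => x - y) (-ContinuousLinearMap.id ℝ (Space d)) y :=
        (hasFDerivAt_id y).const_sub x
      exact Complex.ofRealCLM.hasFDerivAt.comp y
        (((hρs.differentiable (by simp)) (x - y)).hasFDerivAt.comp y e1)
    rw [partialDeriv, hd.fderiv]
    simp
  rw [h1, h2, huv φ hφ, ← integral_neg]
  refine integral_congr_ae (ae_of_all _ fun y => ?_)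
  simp only [hdφ, Complex.real_smul]
  ring

theorem tendsto_integral_mul_of_eLpNorm {f : ℕ → Space d → ℂ} {g ψ : Space d → ℂ}
    (hf : ∀ᶠ n in atTop, MemLp (f n) 1 volume) (hg : MemLp g 1 volume) (hψ : Continuous ψ)
    (hψc : HasCompactSupport ψ)
    (hlim : Tendsto (fun n => eLpNorm (f n - g) 1 volume) atTop (𝓝 0)) :
    Tendsto (fun n => ∫ x, f n x * ψ x) atTop (𝓝 (∫ x, g x * ψ x)) := by
  obtain ⟨C, hC⟩ := hψ.bounded_above_of_compact_support hψc
  have hint {k : Space d → ℂ} (hk : MemLp k 1 volume) : Integrable (fun x => k x * ψ x) :=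
    (memLp_one_iff_integrable.1 hk).mul_bdd hψ.aestronglyMeasurable (ae_of_all _ hC)
  refine tendsto_integral_of_L1' _ (hint hg).1 (hf.mono fun n hn => hint hn) ?_
  have h1 : Tendsto (fun n => ENNReal.ofReal C * eLpNorm (f n - g) 1 volume) atTop (𝓝 0) := by
    simpa using ENNReal.Tendsto.const_mul hlim (Or.inr (ENNReal.ofReal_ne_top (r := C)))
  refine tendsto_of_tendsto_of_tendsto_of_le_of_le tendsto_const_nhds h1 (fun _ => zero_le)
    fun n => ?_
  refine eLpNorm_le_mul_eLpNorm_of_ae_le_mul (ae_of_all _ fun x => ?_) _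
  simp only [Pi.sub_apply, ← sub_mul, norm_mul]
  rw [mul_comm]
  exact mul_le_mul_of_nonneg_right (hC x) (norm_nonneg _)

/-- The chain rule for the composition of a weakly differentiable function with a `C¹` function
with bounded derivative. -/
theorem HasWeakPartial.comp {j : Fin d} {u v : Space d → ℂ} (huv : HasWeakPartial j u v)
    (hu : MemLp u 1 volume) (hv : MemLp v 1 volume) {F : ℂ → ℂ} {F' : ℂ → ℂ →L[ℝ] ℂ}
    (hF : ∀ z, HasFDerivAt F (F' z) z) (hF0 : F 0 = 0) (hF' : Continuous F') {C : ℝ}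
    (hC : ∀ z, ‖F' z‖ ≤ C) :
    HasWeakPartial j (fun x => F (u x)) (fun x => F' (u x) (v x)) := by
  have hC0 : 0 ≤ C := (norm_nonneg _).trans (hC 0)
  have hul := hu.locallyIntegrable le_rfl
  have hvl := hv.locallyIntegrable le_rfl
  have hFc : Continuous F := continuous_iff_continuousAt.2 fun z => (hF z).continuousAt
  have hlip (z w : ℂ) : ‖F z - F w‖ ≤ C * ‖z - w‖ :=
    Convex.norm_image_sub_le_of_norm_hasFDerivWithin_le
      (fun z _ => (hF z).hasFDerivWithinAt) (fun z _ => hC z) convex_univ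
      (Set.mem_univ w) (Set.mem_univ z)
  have hFmem {k : Space d → ℂ} (hk : MemLp k 1 volume) : MemLp (fun x => F (k x)) 1 volume := by
    refine hk.of_le_mul (c := C) (hFc.comp_aestronglyMeasurable hk.1) (ae_of_all _ fun x => ?_)
    simpa [hF0] using hlip (k x) 0
  have happ : Continuous fun q : (ℂ →L[ℝ] ℂ) × ℂ => q.1 q.2 :=
    isBoundedBilinearMap_apply.continuous
  have hF'mem {k l : Space d → ℂ} (hk : AEStronglyMeasurable k volume) (hl : MemLp l 1 volume) :
      MemLp (fun x => F' (k x) (l x)) 1 volume := by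
    refine hl.of_le_mul (c := C) (happ.comp_aestronglyMeasurable
      ((hF'.comp_aestronglyMeasurable hk).prodMk hl.1)) (ae_of_all _ fun x => ?_)
    exact (F' (k x)).le_of_opNorm_le (hC _) _
  intro φ hφ
  have hφ1 : Continuous φ := hφ.1.continuous
  have hdφ : Continuous (partialDeriv j φ) :=
    (hφ.1.continuous_fderiv (by simp)).clm_apply continuous_const
  have hdφc : HasCompactSupport (partialDeriv j φ) := hφ.2.fderiv_apply ℝ _
  have hum (n : ℕ) := (contDiff_mollify hul n).continuous.aestronglyMeasurable (μ := volume)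
  -- Integration by parts for the mollified functions.
  have hparts (n : ℕ) : ∫ x, F' (mollify n u x) (mollify n v x) * φ x =
      -∫ x, F (mollify n u x) * partialDeriv j φ x := by
    have hd (x : Space d) : HasFDerivAt (fun x => F (mollify n u x))
        ((F' (mollify n u x)) ∘L fderiv ℝ (mollify n u) x) x :=
      (hF _).comp x ((contDiff_mollify hul n).differentiable (by simp) x).hasFDerivAt
    have hfd (x : Space d) : fderiv ℝ (fun x => F (mollify n u x)) x (EuclideanSpace.single j 1) =
        F' (mollify n u x) (mollify n v x) := by
      rw [(hd x).fderiv, ← partialDeriv_mollify hul huv]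
      rfl
    have hc1 : Continuous fun x => F (mollify n u x) :=
      hFc.comp (contDiff_mollify hul n).continuous
    have hc2 : Continuous fun x => F' (mollify n u x) (mollify n v x) :=
      happ.comp ((hF'.comp (contDiff_mollify hul n).continuous).prodMk
        (contDiff_mollify hvl n).continuous)
    have := integral_mul_fderiv_eq_neg_fderiv_mul_of_integrable (𝕜 := ℂ) (μ := volume)
      (f := fun x => F (mollify n u x)) (g := φ) (v := EuclideanSpace.single j 1)
      (by
        simp only [hfd]
        exact (hc2.mul hφ1).integrable_of_hasCompactSupport hφ.2.mul_left)
      ((hc1.mul hdφ).integrable_of_hasCompactSupport hdφc.mul_left)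
      ((hc1.mul hφ1).integrable_of_hasCompactSupport hφ.2.mul_left)
      (fun x _ => (hd x).differentiableAt) (fun x _ => hφ.1.differentiable (by simp) x)
    simp only [hfd] at this
    rw [eq_neg_iff_add_eq_zero, add_comm, ← eq_neg_iff_add_eq_zero]
    exact this
  have hulim := tendsto_eLpNorm_mollify le_rfl ENNReal.one_ne_top hu
  have hvlim := tendsto_eLpNorm_mollify le_rfl ENNReal.one_ne_top hv
  have hconst {f : ℕ → ENNReal} (hf : Tendsto f atTop (𝓝 0)) :
      Tendsto (fun n => ENNReal.ofReal C * f n) atTop (𝓝 0) := by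
    simpa using ENNReal.Tendsto.const_mul hf (Or.inr (ENNReal.ofReal_ne_top (r := C)))
  have hright : Tendsto (fun n => ∫ x, F (mollify n u x) * partialDeriv j φ x) atTop
      (𝓝 (∫ x, F (u x) * partialDeriv j φ x)) := by
    refine tendsto_integral_mul_of_eLpNorm
      ((memLp_mollify le_rfl ENNReal.one_ne_top hu).mono fun n hn => hFmem hn) (hFmem hu) hdφ hdφc
      (tendsto_of_tendsto_of_tendsto_of_le_of_le tendsto_const_nhds (hconst hulim)
        (fun _ => zero_le) fun n => ?_)
    exact eLpNorm_le_mul_eLpNorm_of_ae_le_mul (ae_of_all _ fun x => hlip _ _) _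
  have hleft : Tendsto (fun n => ∫ x, F' (mollify n u x) (mollify n v x) * φ x) atTop
      (𝓝 (∫ x, F' (u x) (v x) * φ x)) := by
    refine tendsto_integral_mul_of_eLpNorm
      ((memLp_mollify le_rfl ENNReal.one_ne_top hv).mono fun n hn => hF'mem (hum n) hn)
      (hF'mem hu.1 hv) hφ1 hφ.2 ?_
    have hdom : Tendsto (fun n => eLpNorm ((fun x => F' (mollify n u x) (v x)) -
        fun x => F' (u x) (v x)) 1 volume) atTop (𝓝 0) := by
      refine tendsto_eLpNorm_of_dominated le_rfl ENNReal.one_ne_top (G := fun x => C * ‖v x‖)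
        (fun n => (hF'mem (hum n) hv).1) (hv.norm.const_mul C)
        (fun n => ae_of_all _ fun x => (F' _).le_of_opNorm_le (hC _) _) ?_
      filter_upwards [ae_tendsto_mollify hul] with x hx
      exact (happ.tendsto _).comp (((hF'.tendsto _).comp hx).prodMk_nhds tendsto_const_nhds)
    have hsum := (hconst hvlim).add hdom
    rw [add_zero] at hsum
    refine tendsto_of_tendsto_of_tendsto_of_le_of_le tendsto_const_nhds hsum
      (fun _ => zero_le) fun n => ?_
    have hsplit : (fun x => F' (mollify n u x) (mollify n v x)) - (fun x => F' (u x) (v x)) =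
        (fun x => F' (mollify n u x) ((mollify n v - v) x)) +
          ((fun x => F' (mollify n u x) (v x)) - fun x => F' (u x) (v x)) := by
      ext x
      simp
    have hvm := (contDiff_mollify hvl n).continuous.aestronglyMeasurable (μ := volume)
    rw [hsplit]
    refine (eLpNorm_add_le (happ.comp_aestronglyMeasurable
      ((hF'.comp_aestronglyMeasurable (hum n)).prodMk (hvm.sub hv.1)))
      ((hF'mem (hum n) hv).1.sub (hF'mem hu.1 hv).1) le_rfl).trans ?_
    gcongr
    exact eLpNorm_le_mul_eLpNorm_of_ae_le_mul
      (ae_of_all _ fun x => (F' _).le_of_opNorm_le (hC _) _) _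
  simp only [hparts] at hleft
  exact tendsto_nhds_unique hleft hright.neg

end Magnetic

/-! ### Density of the test functions in the magnetic Sobolev space -/

namespace Magnetic

open scoped Pointwise

variable {d : ℕ} {h : ℝ}

/-- The graph of `φ ↦ (-i h ∇ - a) φ` on the test functions, in `L² × (L²)^d`. -/
def testGraph (h : ℝ) (a : Fin d → Space d → ℂ) : Set (L2 d × (Fin d → L2 d)) :=
  {p | ∃ φ : Space d → ℂ, IsTestFunction φ ∧ (p.1 : Space d → ℂ) =ᵐ[volume] φ ∧
    ∀ j, (p.2 j : Space d → ℂ) =ᵐ[volume]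
      fun x => -Complex.I * h * partialDeriv j φ x - a j x * φ x}

theorem IsTestFunction.mul {φ ψ : Space d → ℂ} (hφ : IsTestFunction φ) (hψ : IsTestFunction ψ) :
    IsTestFunction fun x => φ x * ψ x :=
  ⟨hφ.1.mul hψ.1, hφ.2.mul_right⟩

theorem partialDeriv_mul {φ ψ : Space d → ℂ} (hφ : IsTestFunction φ) (hψ : IsTestFunction ψ)
    (j : Fin d) (x : Space d) :
    partialDeriv j (fun x => φ x * ψ x) x =
      φ x * partialDeriv j ψ x + ψ x * partialDeriv j φ x := by
  have h1 := ((hφ.1.differentiable (by simp) x).hasFDerivAt.mul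
    (hψ.1.differentiable (by simp) x).hasFDerivAt).fderiv
  simp only [partialDeriv]
  rw [show (fun x => φ x * ψ x) = φ * ψ from rfl, h1]
  simp

theorem memLp_magneticDeriv {c : Space d → ℂ} (hc : MemL2Loc c) (h : ℝ) {φ : Space d → ℂ}
    (hφ : IsTestFunction φ) (j : Fin d) :
    MemLp (fun x => -Complex.I * h * partialDeriv j φ x - c x * φ x) 2 volume :=
  ((hφ.memLp_partialDeriv j).const_mul (-Complex.I * h)).sub (hc.memLp_mul hφ)

theorem isWeakMagneticDeriv_toLp {c : Space d → ℂ} {j : Fin d} {f g : Space d → ℂ}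
    (hf : MemLp f 2 volume) (hg : MemLp g 2 volume)
    (hfg : ∀ φ : Space d → ℂ, IsTestFunction φ → ∫ x, g x * φ x =
      ∫ x, f x * (Complex.I * h * partialDeriv j φ x - c x * φ x)) :
    IsWeakMagneticDeriv h c j (hf.toLp f) (hg.toLp g) := by
  intro φ hφ
  have e1 : ∫ x, hg.toLp g x * φ x = ∫ x, g x * φ x := by
    refine integral_congr_ae ?_
    filter_upwards [hg.coeFn_toLp] with x hx
    rw [hx]
  have e2 : ∫ x, hf.toLp f x * (Complex.I * h * partialDeriv j φ x - c x * φ x) =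
      ∫ x, f x * (Complex.I * h * partialDeriv j φ x - c x * φ x) := by
    refine integral_congr_ae ?_
    filter_upwards [hf.coeFn_toLp] with x hx
    rw [hx]
  rw [e1, e2, hfg φ hφ]

theorem tendsto_toLp {f : ℕ → Space d → ℂ} (hf : ∀ n, MemLp (f n) 2 volume) {u : L2 d}
    (hlim : Tendsto (fun n => eLpNorm (f n - (u : Space d → ℂ)) 2 volume) atTop (𝓝 0)) :
    Tendsto (fun n => (hf n).toLp (f n)) atTop (𝓝 u) := by
  rw [Lp.tendsto_Lp_iff_tendsto_eLpNorm']
  refine hlim.congr fun n => eLpNorm_congr_ae ?_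
  filter_upwards [(hf n).coeFn_toLp] with x hx
  simp only [Pi.sub_apply, hx]

theorem memLp_indicator_of_memL2Loc {c : Space d → ℂ} (hc : MemL2Loc c) {K : Set (Space d)}
    (hK : IsCompact K) : MemLp (K.indicator c) 2 volume :=
  (memLp_indicator_iff_restrict hK.measurableSet).2 (hc K hK)

theorem memLp_one_of_compact {f : Space d → ℂ} (hf : MemLp f 2 volume) {K : Set (Space d)}
    (hK : IsCompact K) (hfK : ∀ᵐ x, x ∉ K → f x = 0) : MemLp f 1 volume := by
  have : IsFiniteMeasure ((volume : Measure (Space d)).restrict K) :=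
    ⟨by simpa using hK.measure_lt_top⟩
  have h1 : MemLp (K.indicator f) 1 volume :=
    (memLp_indicator_iff_restrict hK.measurableSet).2
      ((hf.restrict K).mono_exponent (by norm_num))
  refine h1.ae_eq ?_
  filter_upwards [hfK] with x hx
  by_cases hxK : x ∈ K
  · simp [hxK]
  · simp [hxK, hx hxK]

/-- A function with weak derivative `(-i h ∂_j - c) u = w` has `∂_j u = (i / h) (w + c u)`. -/
theorem IsWeakMagneticDeriv.hasWeakPartial (hh : h ≠ 0) {c : Space d → ℂ} (hc : MemL2Loc c)
    {j : Fin d} {u w : L2 d} (huw : IsWeakMagneticDeriv h c j u w) :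
    HasWeakPartial j u (fun x => Complex.I / h * (w x + c x * u x)) := by
  intro φ hφ
  have hh' : (h : ℂ) ≠ 0 := by exact_mod_cast hh
  have i2 : Integrable (fun x => u x * (c x * φ x)) :=
    (Lp.memLp u).integrable_mul (hc.memLp_mul hφ)
  have i3 : Integrable (fun x => u x * partialDeriv j φ x) :=
    (Lp.memLp u).integrable_mul (hφ.memLp_partialDeriv j)
  have e1 : ∫ x, Complex.I / h * (w x + c x * u x) * φ x =
      Complex.I / h * ((∫ x, w x * φ x) + ∫ x, u x * (c x * φ x)) := by
    rw [← integral_add (integrable_mul_test w hφ) i2, ← integral_const_mul]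
    refine integral_congr_ae (ae_of_all _ fun x => ?_)
    ring
  have e2 : ∫ x, u x * (Complex.I * h * partialDeriv j φ x - c x * φ x) =
      Complex.I * h * (∫ x, u x * partialDeriv j φ x) - ∫ x, u x * (c x * φ x) := by
    rw [← integral_const_mul, ← integral_sub (i3.const_mul _) i2]
    refine integral_congr_ae (ae_of_all _ fun x => ?_)
    ring
  rw [e1, huw φ hφ, e2, sub_add_cancel, ← mul_assoc]
  have : Complex.I / h * (Complex.I * h) = -1 := by
    field_simp
    exact Complex.I_sq
  rw [this, neg_one_mul]

theorem HasWeakPartial.congr {j : Fin d} {u u' v v' : Space d → ℂ} (huv : HasWeakPartial j u v)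
    (hu : u =ᵐ[volume] u') (hv : v =ᵐ[volume] v') : HasWeakPartial j u' v' := by
  intro φ hφ
  have e1 : ∫ x, v' x * φ x = ∫ x, v x * φ x := integral_congr_ae (by
    filter_upwards [hv] with x hx
    rw [hx])
  have e2 : ∫ x, u' x * partialDeriv j φ x = ∫ x, u x * partialDeriv j φ x :=
    integral_congr_ae (by
      filter_upwards [hu] with x hx
      rw [hx])
  rw [e1, e2, huv φ hφ]

theorem norm_mollify_le {u : Space d → ℂ} {C : ℝ} (hC : ∀ x, ‖u x‖ ≤ C) (n : ℕ) (x : Space d) :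
    ‖mollify n u x‖ ≤ C := by
  have h1 : Integrable (fun y => (mollifier d n).normed volume y * C) :=
    (mollifier d n).integrable_normed.mul_const C
  refine (norm_integral_le_of_norm_le h1 (ae_of_all _ fun y => ?_)).trans_eq ?_
  · rw [ContinuousLinearMap.lsmul_apply, norm_smul,
      Real.norm_of_nonneg ((mollifier d n).nonneg_normed y)]
    exact mul_le_mul_of_nonneg_left (hC _) ((mollifier d n).nonneg_normed y)
  · rw [integral_mul_const, (mollifier d n).integral_normed, one_mul]

theorem support_mollify_subset {u : Space d → ℂ} {K : Set (Space d)}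
    (hu : ∀ x, x ∉ K → u x = 0) (n : ℕ) :
    Function.support (mollify n u) ⊆ Metric.closedBall (0 : Space d) 1 + K := by
  refine (support_convolution_subset _).trans (Set.add_subset_add ?_ fun x hx => ?_)
  · rw [(mollifier d n).support_normed_eq]
    refine Metric.ball_subset_closedBall.trans (Metric.closedBall_subset_closedBall ?_)
    exact inv_le_one_of_one_le₀ (by simp)
  · by_contra hxK
    exact hx (hu x hxK)

/-- Bounded functions with compact support in the magnetic Sobolev space are limits of test
functions: mollification works, since `a u` is then square integrable. -/
theorem mem_closure_testGraph_of_bounded (hh : h ≠ 0) {a : Fin d → Space d → ℂ}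
    (ha : ∀ j, MemL2Loc (a j)) {u : L2 d} {w : Fin d → L2 d}
    (huw : ∀ j, IsWeakMagneticDeriv h (a j) j u (w j)) {K : Set (Space d)} (hK : IsCompact K)
    (huK : ∀ᵐ x, x ∉ K → u x = 0) {C : ℝ} (huC : ∀ᵐ x, ‖u x‖ ≤ C) :
    (u, w) ∈ closure (testGraph h a) := by
  have hh' : (h : ℂ) ≠ 0 := by exact_mod_cast hh
  -- A representative that is bounded and vanishes off `K` everywhere.
  obtain ⟨f, hfu, hfK, hfC⟩ : ∃ f : Space d → ℂ, (u : Space d → ℂ) =ᵐ[volume] f ∧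
      (∀ x, x ∉ K → f x = 0) ∧ ∀ x, ‖f x‖ ≤ |C| := by
    refine ⟨{x | x ∈ K ∧ ‖u x‖ ≤ C}.indicator u, ?_, fun x hx => ?_, fun x => ?_⟩
    · filter_upwards [huK, huC] with x h1 h2
      by_cases hx : x ∈ K
      · rw [Set.indicator_of_mem (show x ∈ {x | x ∈ K ∧ ‖u x‖ ≤ C} from ⟨hx, h2⟩)]
      · rw [Set.indicator_of_notMem fun hx' => hx hx'.1, h1 hx]
    · exact Set.indicator_of_notMem (fun hx' => hx hx'.1) _
    · by_cases hx : x ∈ {x | x ∈ K ∧ ‖u x‖ ≤ C}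
      · rw [Set.indicator_of_mem hx]
        exact hx.2.trans (le_abs_self C)
      · rw [Set.indicator_of_notMem hx, norm_zero]
        exact abs_nonneg C
  have hf : MemLp f 2 volume := (Lp.memLp u).ae_eq hfu
  have hfl : LocallyIntegrable f volume := hf.locallyIntegrable (by norm_num)
  have haf (j : Fin d) : MemLp (fun x => a j x * f x) 2 volume := by
    have h1 : MemLp (fun x => K.indicator (a j) x * f x) 2 volume := by
      have h2 := memLp_indicator_of_memL2Loc (ha j) hK
      refine h2.of_le_mul (c := |C|) (h2.1.mul hf.1) (ae_of_all _ fun x => ?_)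
      rw [norm_mul, mul_comm]
      exact mul_le_mul_of_nonneg_right (hfC x) (norm_nonneg _)
    refine h1.ae_eq (ae_of_all _ fun x => ?_)
    by_cases hx : x ∈ K
    · simp only [Set.indicator_of_mem hx]
    · simp only [hfK x hx, mul_zero]
  let v (j : Fin d) (x : Space d) : ℂ := Complex.I / h * (w j x + a j x * f x)
  have hv (j : Fin d) : MemLp (v j) 2 volume := ((Lp.memLp (w j)).add (haf j)).const_mul _
  have hfv (j : Fin d) : HasWeakPartial j f (v j) := by
    refine ((huw j).hasWeakPartial hh (ha j)).congr hfu ?_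
    filter_upwards [hfu] with x hx
    simp only [v, hx]
  let K' : Set (Space d) := Metric.closedBall (0 : Space d) 1 + K
  have hK' : IsCompact K' := (isCompact_closedBall 0 1).add hK
  have hsupp (n : ℕ) : Function.support (mollify n f) ⊆ K' := support_mollify_subset hfK n
  have htest (n : ℕ) : IsTestFunction (mollify n f) :=
    ⟨contDiff_mollify hfl n, hK'.closure_of_subset (hsupp n)⟩
  have hseq : Tendsto (fun n => (((htest n).memLp.toLp (mollify n f) : L2 d),
      fun j => ((memLp_magneticDeriv (ha j) h (htest n) j).toLp _ : L2 d))) atTop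
      (𝓝 (u, w)) := by
    refine Tendsto.prodMk_nhds (tendsto_toLp _ ?_) (tendsto_pi_nhds.2 fun j => tendsto_toLp _ ?_)
    · refine (tendsto_eLpNorm_mollify (by norm_num) (by norm_num) hf).congr fun n =>
        eLpNorm_congr_ae ?_
      filter_upwards [hfu] with x hx
      simp only [Pi.sub_apply, hx]
    · have h1 := (tendsto_eLpNorm_mollify (by norm_num) (by norm_num) (hv j))
      have h2 : Tendsto (fun n => eLpNorm ((fun x => a j x * mollify n f x) -
          fun x => a j x * f x) 2 volume) atTop (𝓝 0) := by
        refine tendsto_eLpNorm_of_dominated (by norm_num) (by norm_num)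
          (G := fun x => |C| * ‖K'.indicator (a j) x‖)
          (fun n => ((ha j).memLp_mul (htest n)).1)
          ((memLp_indicator_of_memL2Loc (ha j) hK').norm.const_mul _)
          (fun n => ae_of_all _ fun x => ?_) ?_
        · by_cases hx : x ∈ K'
          · rw [Set.indicator_of_mem hx, norm_mul, mul_comm]
            exact mul_le_mul_of_nonneg_right (norm_mollify_le hfC n x) (norm_nonneg _)
          · have : mollify n f x = 0 := by
              by_contra hne
              exact hx (hsupp n hne)
            rw [this, mul_zero, norm_zero]
            positivity
        · filter_upwards [ae_tendsto_mollify hfl] with x hx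
          exact hx.const_mul _
      have h3 := (ENNReal.Tendsto.const_mul h1
        (Or.inr (enorm_ne_top (x := -Complex.I * (h : ℂ))))).add h2
      rw [mul_zero, add_zero] at h3
      refine tendsto_of_tendsto_of_tendsto_of_le_of_le tendsto_const_nhds h3
        (fun _ => zero_le) fun n => ?_
      have hvm : AEStronglyMeasurable (mollify n (v j)) volume :=
        (contDiff_mollify ((hv j).locallyIntegrable (by norm_num)) n).continuous
          |>.aestronglyMeasurable
      have hsplit : ((fun x => -Complex.I * h * partialDeriv j (mollify n f) x -
          a j x * mollify n f x) - (w j : Space d → ℂ)) =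
          (-Complex.I * (h : ℂ)) • (mollify n (v j) - v j) -
            ((fun x => a j x * mollify n f x) - fun x => a j x * f x) := by
        ext x
        have hwx : w j x = -Complex.I * h * v j x - a j x * f x := by
          simp only [v]
          have : -Complex.I * h * (Complex.I / h * (w j x + a j x * f x)) =
              -(Complex.I * Complex.I) * (w j x + a j x * f x) := by
            field_simp
          rw [this, Complex.I_mul_I]
          ring
        simp only [Pi.sub_apply, Pi.smul_apply, smul_eq_mul,
          partialDeriv_mollify hfl (hfv j), hwx]
        ring
      rw [hsplit]
      refine (eLpNorm_sub_le ((hvm.sub (hv j).1).const_smul _)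
        (((ha j).memLp_mul (htest n)).1.sub (haf j).1) (by norm_num)).trans ?_
      rw [eLpNorm_const_smul]
  refine mem_closure_of_tendsto hseq (Eventually.of_forall fun n => ?_)
  exact ⟨mollify n f, htest n, (htest n).memLp.coeFn_toLp,
    fun j => (memLp_magneticDeriv (ha j) h (htest n) j).coeFn_toLp⟩

/-! ### Truncation and cutoff -/

/-- A smooth truncation `z ↦ z / (1 + ε² |z|²)` of the identity of `ℂ`. It is bounded and
commutes with rotations about the origin. -/
noncomputable def truncate (ε : ℝ) (z : ℂ) : ℂ := (1 + ε ^ 2 * ‖z‖ ^ 2)⁻¹ • z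

/-- The real derivative of `truncate ε`. -/
noncomputable def truncateDeriv (ε : ℝ) (z : ℂ) : ℂ →L[ℝ] ℂ :=
  (1 + ε ^ 2 * ‖z‖ ^ 2)⁻¹ • ContinuousLinearMap.id ℝ ℂ -
    (2 * ε ^ 2 * ((1 + ε ^ 2 * ‖z‖ ^ 2)⁻¹) ^ 2) • (innerSL ℝ z).smulRight z

theorem truncateDeriv_apply (ε : ℝ) (z k : ℂ) :
    truncateDeriv ε z k = (1 + ε ^ 2 * ‖z‖ ^ 2)⁻¹ • k -
      (2 * ε ^ 2 * ((1 + ε ^ 2 * ‖z‖ ^ 2)⁻¹) ^ 2) • (inner ℝ z k • z) := rfl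

theorem truncate_zero (ε : ℝ) : truncate ε 0 = 0 := by simp [truncate]

theorem one_add_sq_mul_pos (ε : ℝ) (z : ℂ) : 0 < 1 + ε ^ 2 * ‖z‖ ^ 2 := by positivity

theorem hasFDerivAt_truncate (ε : ℝ) (z : ℂ) : HasFDerivAt (truncate ε) (truncateDeriv ε z) z := by
  have h1 : HasFDerivAt (fun z : ℂ => 1 + ε ^ 2 * ‖z‖ ^ 2) (ε ^ 2 • (2 • innerSL ℝ z)) z :=
    ((hasStrictFDerivAt_norm_sq z).hasFDerivAt.const_mul (ε ^ 2)).const_add 1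
  have h2 := (hasDerivAt_inv (one_add_sq_mul_pos ε z).ne').comp_hasFDerivAt z h1
  refine (h2.smul (hasFDerivAt_id z)).congr_fderiv ?_
  ext1 k
  simp only [truncateDeriv_apply, add_apply, smul_apply, ContinuousLinearMap.smulRight_apply,
    ContinuousLinearMap.id_apply, innerSL_apply_apply, Function.comp_apply, id, Complex.real_smul,
    smul_eq_mul, nsmul_eq_mul]
  push_cast
  simp only [inv_pow]
  ring

theorem continuous_truncate (ε : ℝ) : Continuous (truncate ε) :=
  continuous_iff_continuousAt.2 fun z => (hasFDerivAt_truncate ε z).continuousAt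

theorem continuous_truncateDeriv (ε : ℝ) : Continuous (truncateDeriv ε) := by
  have h1 : Continuous fun z : ℂ => (1 + ε ^ 2 * ‖z‖ ^ 2)⁻¹ :=
    Continuous.inv₀ (by fun_prop) fun z => (one_add_sq_mul_pos ε z).ne'
  have h2 : Continuous fun z : ℂ => (innerSL ℝ z).smulRight z :=
    ((ContinuousLinearMap.smulRightL ℝ ℂ ℂ).continuous.comp (innerSL ℝ).continuous).clm_apply
      continuous_id
  exact (h1.smul continuous_const).sub ((continuous_const.mul (h1.pow 2)).smul h2)

theorem inv_one_add_sq_le_one (ε : ℝ) (z : ℂ) : (1 + ε ^ 2 * ‖z‖ ^ 2)⁻¹ ≤ 1 :=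
  inv_le_one_of_one_le₀ (by nlinarith [sq_nonneg (ε * ‖z‖)])

theorem norm_truncate_le (ε : ℝ) (z : ℂ) : ‖truncate ε z‖ ≤ ‖z‖ := by
  have h1 := one_add_sq_mul_pos ε z
  rw [truncate, norm_smul, Real.norm_of_nonneg (by positivity)]
  exact mul_le_of_le_one_left (norm_nonneg _) (inv_one_add_sq_le_one ε z)

theorem norm_truncate_le_inv {ε : ℝ} (hε : 0 < ε) (z : ℂ) : ‖truncate ε z‖ ≤ ε⁻¹ := by
  have h1 := one_add_sq_mul_pos ε z
  rw [truncate, norm_smul, Real.norm_of_nonneg (by positivity), inv_mul_le_iff₀ h1,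
    ← div_eq_mul_inv, le_div_iff₀ hε]
  nlinarith [sq_nonneg (ε * ‖z‖ - 1), mul_nonneg hε.le (norm_nonneg z)]

theorem norm_truncateDeriv_le (ε : ℝ) (z : ℂ) : ‖truncateDeriv ε z‖ ≤ 3 := by
  refine ContinuousLinearMap.opNorm_le_bound _ (by norm_num) fun k => ?_
  have h1 := one_add_sq_mul_pos ε z
  set s := (1 + ε ^ 2 * ‖z‖ ^ 2)⁻¹ with hs
  have hs0 : 0 < s := by positivity
  have hs1 : s ≤ 1 := inv_one_add_sq_le_one ε z
  have hs2 : s * (ε ^ 2 * ‖z‖ ^ 2) ≤ 1 := by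
    have : s * (1 + ε ^ 2 * ‖z‖ ^ 2) = 1 := inv_mul_cancel₀ h1.ne'
    nlinarith
  rw [truncateDeriv_apply, ← hs]
  refine (norm_sub_le _ _).trans ?_
  rw [norm_smul, norm_smul, norm_smul, Real.norm_of_nonneg hs0.le,
    Real.norm_of_nonneg (by positivity)]
  have h2 : ‖inner ℝ z k‖ * ‖z‖ ≤ ‖z‖ ^ 2 * ‖k‖ := by
    have := mul_le_mul_of_nonneg_right (norm_inner_le_norm (𝕜 := ℝ) z k) (norm_nonneg z)
    linarith
  calc s * ‖k‖ + 2 * ε ^ 2 * s ^ 2 * (‖inner ℝ z k‖ * ‖z‖)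
      ≤ s * ‖k‖ + 2 * ε ^ 2 * s ^ 2 * (‖z‖ ^ 2 * ‖k‖) := by gcongr
    _ = s * (1 + 2 * (s * (ε ^ 2 * ‖z‖ ^ 2))) * ‖k‖ := by ring
    _ ≤ 1 * (1 + 2 * 1) * ‖k‖ := by gcongr
    _ = 3 * ‖k‖ := by ring

/-- Infinitesimal form of the rotation invariance of `truncate ε`. -/
theorem truncateDeriv_apply_I_mul (ε r : ℝ) (z : ℂ) :
    truncateDeriv ε z (r * (Complex.I * z)) = r * (Complex.I * truncate ε z) := by
  have h1 : inner ℝ z ((r : ℂ) * (Complex.I * z)) = 0 := by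
    rw [Complex.inner]
    simp
    ring
  rw [truncateDeriv_apply, h1, zero_smul, smul_zero, sub_zero, truncate]
  simp only [Complex.real_smul]
  ring

theorem tendsto_truncate (z : ℂ) : Tendsto (fun ε => truncate ε z) (𝓝 0) (𝓝 z) := by
  have h1 : Continuous fun ε : ℝ => truncate ε z :=
    (Continuous.inv₀ (by fun_prop) fun ε => (one_add_sq_mul_pos ε z).ne').smul continuous_const
  simpa [truncate] using h1.tendsto 0

theorem tendsto_truncateDeriv (z k : ℂ) :
    Tendsto (fun ε => truncateDeriv ε z k) (𝓝 0) (𝓝 k) := by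
  have h1 : Continuous fun ε : ℝ => (1 + ε ^ 2 * ‖z‖ ^ 2)⁻¹ :=
    Continuous.inv₀ (by fun_prop) fun ε => (one_add_sq_mul_pos ε z).ne'
  have h2 : Continuous fun ε : ℝ => truncateDeriv ε z k := by
    simp only [truncateDeriv_apply]
    fun_prop
  simpa [truncateDeriv_apply] using h2.tendsto 0

/-- Truncation in the magnetic Sobolev space with a real potential: since `truncate ε` commutes
with rotations, the potential drops out of the formula for `(-i h ∂_j - a) (truncate ε u)`. -/
theorem IsWeakMagneticDeriv.truncate (hh : h ≠ 0) {a : Space d → ℂ} (ha : MemL2Loc a)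
    (hreal : ∀ x, ((a x).re : ℂ) = a x) {j : Fin d} {u w : L2 d}
    (huw : IsWeakMagneticDeriv h a j u w) {K : Set (Space d)} (hK : IsCompact K)
    (huK : ∀ᵐ x, x ∉ K → u x = 0) (hwK : ∀ᵐ x, x ∉ K → w x = 0) (ε : ℝ)
    (hT : MemLp (fun x => truncate ε (u x)) 2 volume)
    (hT' : MemLp (fun x => -Complex.I * h * truncateDeriv ε (u x) (Complex.I / h * w x)) 2
      volume) :
    IsWeakMagneticDeriv h a j (hT.toLp _) (hT'.toLp _) := by
  have hh' : (h : ℂ) ≠ 0 := by exact_mod_cast hh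
  have hau : MemLp (fun x => a x * u x) 1 volume := by
    rw [memLp_one_iff_integrable]
    refine ((memLp_indicator_of_memL2Loc ha hK).integrable_mul (Lp.memLp u)).congr ?_
    filter_upwards [huK] with x hx
    by_cases hxK : x ∈ K
    · simp [hxK]
    · simp [hxK, hx hxK]
  have hv : MemLp (fun x => Complex.I / h * (w x + a x * u x)) 1 volume :=
    ((memLp_one_of_compact (Lp.memLp w) hK hwK).add hau).const_mul _
  have hchain := (huw.hasWeakPartial hh ha).comp (memLp_one_of_compact (Lp.memLp u) hK huK) hv
    (hasFDerivAt_truncate ε) (truncate_zero ε) (continuous_truncateDeriv ε)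
    (norm_truncateDeriv_le ε)
  have hpoint (x : Space d) : -Complex.I * h * truncateDeriv ε (u x) (Complex.I / h * w x) =
      -Complex.I * h * truncateDeriv ε (u x) (Complex.I / h * (w x + a x * u x)) -
        a x * Magnetic.truncate ε (u x) := by
    have h1 : Complex.I / h * (w x + a x * u x) =
        Complex.I / h * w x + (((a x).re / h : ℝ) : ℂ) * (Complex.I * u x) := by
      push_cast
      rw [hreal]
      ring
    rw [h1, map_add, truncateDeriv_apply_I_mul]
    push_cast
    rw [hreal]
    have h2 : -Complex.I * h * (a x / h * (Complex.I * Magnetic.truncate ε (u x))) =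
        -(Complex.I * Complex.I) * (a x * Magnetic.truncate ε (u x)) := by
      field_simp
    rw [mul_add, h2, Complex.I_mul_I]
    ring
  refine isWeakMagneticDeriv_toLp hT hT' fun φ hφ => ?_
  have i1 : Integrable (fun x => Magnetic.truncate ε (u x) * partialDeriv j φ x) :=
    hT.integrable_mul (hφ.memLp_partialDeriv j)
  have i2 : Integrable (fun x => Magnetic.truncate ε (u x) * (a x * φ x)) :=
    hT.integrable_mul (ha.memLp_mul hφ)
  have i3 : Integrable (fun x => -Complex.I * h *
      truncateDeriv ε (u x) (Complex.I / h * (w x + a x * u x)) * φ x) := by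
    refine ((hT'.integrable_mul hφ.memLp).add i2).congr (ae_of_all _ fun x => ?_)
    simp only [Pi.add_apply, Pi.mul_apply, hpoint]
    ring
  have e1 : ∫ x, Magnetic.truncate ε (u x) * (Complex.I * h * partialDeriv j φ x - a x * φ x) =
      Complex.I * h * (∫ x, Magnetic.truncate ε (u x) * partialDeriv j φ x) -
        ∫ x, Magnetic.truncate ε (u x) * (a x * φ x) := by
    rw [← integral_const_mul, ← integral_sub (i1.const_mul _) i2]
    refine integral_congr_ae (ae_of_all _ fun x => ?_)
    ring
  have e2 : ∫ x, -Complex.I * h * truncateDeriv ε (u x) (Complex.I / h * w x) * φ x =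
      -Complex.I * h *
        (∫ x, truncateDeriv ε (u x) (Complex.I / h * (w x + a x * u x)) * φ x) -
        ∫ x, Magnetic.truncate ε (u x) * (a x * φ x) := by
    rw [← integral_const_mul]
    simp only [← mul_assoc (-Complex.I * (h : ℂ))]
    rw [← integral_sub i3 i2]
    refine integral_congr_ae (ae_of_all _ fun x => ?_)
    simp only [hpoint]
    ring
  rw [e1, e2, hchain φ hφ]
  ring

theorem tendsto_inv_natCast_add_one : Tendsto (fun n : ℕ => ((n : ℝ) + 1)⁻¹) atTop (𝓝 0) := by
  simpa [one_div] using tendsto_one_div_add_atTop_nhds_zero_nat (𝕜 := ℝ)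

/-- Truncation removes the boundedness assumption in `mem_closure_testGraph_of_bounded`. -/
theorem mem_closure_testGraph_of_compact (hh : h ≠ 0) {a : Fin d → Space d → ℂ}
    (ha : ∀ j, MemL2Loc (a j)) (hreal : ∀ j x, ((a j x).re : ℂ) = a j x) {u : L2 d}
    {w : Fin d → L2 d} (huw : ∀ j, IsWeakMagneticDeriv h (a j) j u (w j)) {K : Set (Space d)}
    (hK : IsCompact K) (huK : ∀ᵐ x, x ∉ K → u x = 0) (hwK : ∀ j, ∀ᵐ x, x ∉ K → w j x = 0) :
    (u, w) ∈ closure (testGraph h a) := by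
  have hh' : (h : ℂ) ≠ 0 := by exact_mod_cast hh
  have happ : Continuous fun q : (ℂ →L[ℝ] ℂ) × ℂ => q.1 q.2 :=
    isBoundedBilinearMap_apply.continuous
  have hum := (Lp.memLp u).1
  have hT (ε : ℝ) : MemLp (fun x => truncate ε (u x)) 2 volume :=
    (Lp.memLp u).of_le ((continuous_truncate ε).comp_aestronglyMeasurable hum)
      (ae_of_all _ fun x => norm_truncate_le ε _)
  have hcancel (z : ℂ) : ‖-Complex.I * (h : ℂ)‖ * (3 * ‖Complex.I / h * z‖) = 3 * ‖z‖ := by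
    have : ‖(h : ℂ)‖ ≠ 0 := norm_ne_zero_iff.2 hh'
    simp only [norm_mul, norm_neg, norm_div, Complex.norm_I]
    field_simp
  have hbound (ε : ℝ) (j : Fin d) (x : Space d) :
      ‖-Complex.I * h * truncateDeriv ε (u x) (Complex.I / h * w j x)‖ ≤ 3 * ‖w j x‖ := by
    rw [norm_mul, ← hcancel]
    exact mul_le_mul_of_nonneg_left
      ((truncateDeriv ε (u x)).le_of_opNorm_le (norm_truncateDeriv_le _ _) _) (norm_nonneg _)
  have hT' (ε : ℝ) (j : Fin d) :
      MemLp (fun x => -Complex.I * h * truncateDeriv ε (u x) (Complex.I / h * w j x)) 2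
        volume := by
    refine (Lp.memLp (w j)).of_le_mul (c := 3) ?_ (ae_of_all _ fun x => hbound ε j x)
    exact (happ.comp_aestronglyMeasurable (((continuous_truncateDeriv ε).comp_aestronglyMeasurable
      hum).prodMk ((Lp.memLp (w j)).1.const_mul _))).const_mul _
  let ε (n : ℕ) : ℝ := ((n : ℝ) + 1)⁻¹
  have hε (n : ℕ) : 0 < ε n := by positivity
  have hseq : Tendsto (fun n => (((hT (ε n)).toLp _ : L2 d),
      fun j => ((hT' (ε n) j).toLp _ : L2 d))) atTop (𝓝 (u, w)) := by
    refine Tendsto.prodMk_nhds (tendsto_toLp _ ?_) (tendsto_pi_nhds.2 fun j => tendsto_toLp _ ?_)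
    · exact tendsto_eLpNorm_of_dominated (by norm_num) (by norm_num) (fun n => (hT (ε n)).1)
        (Lp.memLp u).norm (fun n => ae_of_all _ fun x => norm_truncate_le _ _)
        (ae_of_all _ fun x => (tendsto_truncate (u x)).comp tendsto_inv_natCast_add_one)
    · refine tendsto_eLpNorm_of_dominated (by norm_num) (by norm_num)
        (fun n => (hT' (ε n) j).1) ((Lp.memLp (w j)).norm.const_mul 3)
        (fun n => ae_of_all _ fun x => hbound _ j x) (ae_of_all _ fun x => ?_)
      have h1 := ((tendsto_truncateDeriv (u x) (Complex.I / h * w j x)).comp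
        tendsto_inv_natCast_add_one).const_mul (-Complex.I * (h : ℂ))
      have h2 : -Complex.I * h * (Complex.I / h * w j x) = w j x := by
        have : -Complex.I * h * (Complex.I / h * w j x) = -(Complex.I * Complex.I) * w j x := by
          field_simp
        rw [this, Complex.I_mul_I]
        ring
      rwa [h2] at h1
  rw [← closure_closure]
  refine mem_closure_of_tendsto hseq (Eventually.of_forall fun n => ?_)
  refine mem_closure_testGraph_of_bounded hh ha (C := (ε n)⁻¹)
    (fun j => (huw j).truncate hh (ha j) (hreal j) hK huK (hwK j) (ε n) _ _) hK ?_ ?_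
  · filter_upwards [(hT (ε n)).coeFn_toLp, huK] with x hx hxK hxn
    rw [hx, hxK hxn, truncate_zero]
  · filter_upwards [(hT (ε n)).coeFn_toLp] with x hx
    rw [hx]
    exact norm_truncate_le_inv (hε n) _

/-- Multiplication by a test function in the magnetic Sobolev space (Leibniz rule). -/
theorem IsWeakMagneticDeriv.mul_test {c : Space d → ℂ} (hc : MemL2Loc c) {j : Fin d} {u w : L2 d}
    (huw : IsWeakMagneticDeriv h c j u w) {χ : Space d → ℂ} (hχ : IsTestFunction χ)
    (hf : MemLp (fun x => χ x * u x) 2 volume)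
    (hg : MemLp (fun x => χ x * w x - Complex.I * h * partialDeriv j χ x * u x) 2 volume) :
    IsWeakMagneticDeriv h c j (hf.toLp _) (hg.toLp _) := by
  refine isWeakMagneticDeriv_toLp hf hg fun φ hφ => ?_
  have i1 := integrable_mul_test w (hχ.mul hφ)
  have i2 := integrable_weak hc h j u (hχ.mul hφ)
  have i3 : Integrable (fun x => Complex.I * h * partialDeriv j χ x * u x * φ x) := by
    refine (i1.sub (hg.integrable_mul hφ.memLp)).congr (ae_of_all _ fun x => ?_)
    simp only [Pi.sub_apply, Pi.mul_apply]
    ring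
  have e1 : ∫ x, (χ x * w x - Complex.I * h * partialDeriv j χ x * u x) * φ x =
      (∫ x, w x * (χ x * φ x)) - ∫ x, Complex.I * h * partialDeriv j χ x * u x * φ x := by
    rw [← integral_sub i1 i3]
    refine integral_congr_ae (ae_of_all _ fun x => ?_)
    ring
  rw [e1, huw _ (hχ.mul hφ), ← integral_sub i2 i3]
  refine integral_congr_ae (ae_of_all _ fun x => ?_)
  simp only [partialDeriv_mul hχ hφ]
  ring

/-- Test functions bounded by `1` that converge to `1` pointwise, with derivatives tending to `0`
uniformly. -/
theorem exists_cutoff (d : ℕ) : ∃ (χ : ℕ → Space d → ℂ) (C : ℝ), (∀ n, IsTestFunction (χ n)) ∧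
    (∀ n x, ‖χ n x‖ ≤ 1) ∧ (∀ n j x, ‖partialDeriv j (χ n) x‖ ≤ ((n : ℝ) + 1)⁻¹ * C) ∧
    ∀ x, Tendsto (fun n => χ n x) atTop (𝓝 1) := by
  let b : ContDiffBump (0 : Space d) := ⟨1, 2, one_pos, one_lt_two⟩
  have hb : IsTestFunction fun x => (b x : ℂ) :=
    ⟨Complex.ofRealCLM.contDiff.comp b.contDiff,
      b.hasCompactSupport.comp_left (g := Complex.ofReal) rfl⟩
  obtain ⟨C, hC⟩ := (hb.1.continuous_fderiv (by simp)).bounded_above_of_compact_support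
    (hb.2.fderiv ℝ)
  have hd (n : ℕ) (x : Space d) : HasFDerivAt (fun x => (b (((n : ℝ) + 1)⁻¹ • x) : ℂ))
      (fderiv ℝ (fun x => (b x : ℂ)) (((n : ℝ) + 1)⁻¹ • x) ∘L
        (((n : ℝ) + 1)⁻¹ • ContinuousLinearMap.id ℝ (Space d))) x :=
    ((hb.1.differentiable (by simp)) (((n : ℝ) + 1)⁻¹ • x)).hasFDerivAt.comp x
      (((n : ℝ) + 1)⁻¹ • ContinuousLinearMap.id ℝ (Space d)).hasFDerivAt
  refine ⟨fun n x => (b (((n : ℝ) + 1)⁻¹ • x) : ℂ), C, fun n => ⟨?_, ?_⟩, fun n x => ?_,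
    fun n j x => ?_, fun x => ?_⟩
  · exact hb.1.comp (contDiff_const_smul _)
  · have hne : ((n : ℝ) + 1)⁻¹ ≠ 0 := by positivity
    exact hb.2.comp_homeomorph (Homeomorph.smulOfNeZero _ hne)
  · rw [Complex.norm_real, Real.norm_of_nonneg b.nonneg]
    exact b.le_one
  · rw [partialDeriv, (hd n x).fderiv]
    have hpos : 0 ≤ ((n : ℝ) + 1)⁻¹ := by positivity
    have h1 := (fderiv ℝ (fun x => (b x : ℂ)) (((n : ℝ) + 1)⁻¹ • x)).le_of_opNorm_le (hC _)
      (EuclideanSpace.single j (1 : ℝ))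
    rw [PiLp.norm_single, norm_one, mul_one] at h1
    simp only [ContinuousLinearMap.comp_apply, smul_apply, ContinuousLinearMap.id_apply,
      map_smul, norm_smul, Real.norm_of_nonneg hpos]
    exact mul_le_mul_of_nonneg_left h1 hpos
  · have h1 : Tendsto (fun n : ℕ => ((n : ℝ) + 1)⁻¹ • x) atTop (𝓝 0) := by
      simpa using tendsto_inv_natCast_add_one.smul_const x
    have h2 := (hb.1.continuous.tendsto 0).comp h1
    have h3 : b 0 = 1 := b.one_of_mem_closedBall (by simp [b])
    simpa [h3, Function.comp_def] using h2

/-- The test functions are dense in the magnetic Sobolev space of a real potential in `L²_loc`. -/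
theorem mem_closure_testGraph (hh : h ≠ 0) {a : Fin d → Space d → ℂ}
    (ha : ∀ j, MemL2Loc (a j)) (hreal : ∀ j x, ((a j x).re : ℂ) = a j x) {u : L2 d}
    {w : Fin d → L2 d} (huw : ∀ j, IsWeakMagneticDeriv h (a j) j u (w j)) :
    (u, w) ∈ closure (testGraph h a) := by
  obtain ⟨χ, C, hχ, hχ1, hχd, hχlim⟩ := exists_cutoff d
  have hum := (Lp.memLp u).1
  have hf (n : ℕ) : MemLp (fun x => χ n x * u x) 2 volume :=
    (Lp.memLp u).of_le ((hχ n).1.continuous.aestronglyMeasurable.mul hum)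
      (ae_of_all _ fun x => by
        rw [norm_mul]
        exact mul_le_of_le_one_left (norm_nonneg _) (hχ1 n x))
  have hC0 (j : Fin d) : 0 ≤ C := by
    have := (norm_nonneg _).trans (hχd 0 j 0)
    simpa using this
  have hle (n : ℕ) (j : Fin d) (x : Space d) : ‖partialDeriv j (χ n) x‖ ≤ C := by
    refine (hχd n j x).trans (mul_le_of_le_one_left (hC0 j) (inv_le_one_of_one_le₀ ?_))
    simp
  have hbound (n : ℕ) (j : Fin d) (x : Space d) :
      ‖χ n x * w j x - Complex.I * h * partialDeriv j (χ n) x * u x‖ ≤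
        ‖w j x‖ + |h| * C * ‖u x‖ := by
    refine (norm_sub_le _ _).trans (add_le_add ?_ ?_)
    · rw [norm_mul]
      exact mul_le_of_le_one_left (norm_nonneg _) (hχ1 n x)
    · rw [norm_mul, norm_mul, norm_mul, Complex.norm_I, one_mul, Complex.norm_real,
        Real.norm_eq_abs]
      gcongr
      exact hle n j x
  have hdc (n : ℕ) (j : Fin d) : Continuous (partialDeriv j (χ n)) :=
    ((hχ n).1.continuous_fderiv (by simp)).clm_apply continuous_const
  have hG (j : Fin d) : MemLp (fun x => ‖w j x‖ + |h| * C * ‖u x‖) 2 volume :=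
    (Lp.memLp (w j)).norm.add ((Lp.memLp u).norm.const_mul _)
  have hg (n : ℕ) (j : Fin d) :
      MemLp (fun x => χ n x * w j x - Complex.I * h * partialDeriv j (χ n) x * u x) 2 volume := by
    refine (hG j).of_le (((hχ n).1.continuous.aestronglyMeasurable.mul (Lp.memLp (w j)).1).sub
      (((hdc n j).aestronglyMeasurable.const_mul _).mul hum)) (ae_of_all _ fun x => ?_)
    exact (hbound n j x).trans (Real.le_norm_self _)
  have hseq : Tendsto (fun n => (((hf n).toLp _ : L2 d), fun j => ((hg n j).toLp _ : L2 d)))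
      atTop (𝓝 (u, w)) := by
    refine Tendsto.prodMk_nhds (tendsto_toLp _ ?_) (tendsto_pi_nhds.2 fun j => tendsto_toLp _ ?_)
    · refine tendsto_eLpNorm_of_dominated (by norm_num) (by norm_num) (fun n => (hf n).1)
        (Lp.memLp u).norm (fun n => ae_of_all _ fun x => ?_) (ae_of_all _ fun x => ?_)
      · rw [norm_mul]
        exact mul_le_of_le_one_left (norm_nonneg _) (hχ1 n x)
      · simpa using (hχlim x).mul_const (u x)
    · refine tendsto_eLpNorm_of_dominated (by norm_num) (by norm_num) (fun n => (hg n j).1)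
        (hG j) (fun n => ae_of_all _ fun x => hbound n j x) (ae_of_all _ fun x => ?_)
      have h1 : Tendsto (fun n => partialDeriv j (χ n) x) atTop (𝓝 0) := by
        have := tendsto_inv_natCast_add_one.mul_const C
        rw [zero_mul] at this
        exact squeeze_zero_norm (fun n => hχd n j x) this
      simpa using ((hχlim x).mul_const (w j x)).sub
        ((h1.const_mul (Complex.I * (h : ℂ))).mul_const (u x))
  rw [← closure_closure]
  refine mem_closure_of_tendsto hseq (Eventually.of_forall fun n => ?_)
  refine mem_closure_testGraph_of_compact hh ha hreal
    (fun j => (huw j).mul_test (ha j) (hχ n) _ _) (hχ n).2 ?_ fun j => ?_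
  · filter_upwards [(hf n).coeFn_toLp] with x hx hxn
    rw [hx, image_eq_zero_of_notMem_tsupport hxn, zero_mul]
  · filter_upwards [(hg n j).coeFn_toLp] with x hx hxn
    have h1 : partialDeriv j (χ n) x = 0 := by
      rw [partialDeriv, image_eq_zero_of_notMem_tsupport
        (fun h' => hxn (tsupport_fderiv_subset ℝ h')), zero_apply]
    rw [hx, image_eq_zero_of_notMem_tsupport hxn, h1]
    ring

end Magnetic

/-! ### Square-integrable functions and distributions -/

namespace Magnetic

variable {d : ℕ} {h : ℝ}

theorem norm_sq_eq_integral (f : L2 d) : ‖f‖ ^ 2 = ∫ x, ‖f x‖ ^ 2 := by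
  have h1 := inner_self_eq_norm_sq_to_K (𝕜 := ℂ) f
  rw [L2.inner_def] at h1
  simp only [inner_self_eq_norm_sq_to_K] at h1
  norm_cast at h1
  exact h1.symm

theorem integrable_norm_sq {f : Space d → ℂ} (hf : MemLp f 2 volume) :
    Integrable (fun x => ‖f x‖ ^ 2) :=
  (memLp_two_iff_integrable_sq_norm hf.1).1 hf

theorem continuous_integral_mul {ψ : Space d → ℂ} (hψ : MemLp ψ 2 volume) :
    Continuous fun u : L2 d => ∫ x, u x * ψ x := by
  have h1 (u : L2 d) : ∫ x, u x * ψ x = inner ℂ (hψ.star.toLp _) u := by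
    rw [L2.inner_def]
    refine integral_congr_ae ?_
    filter_upwards [hψ.star.coeFn_toLp] with x hx
    simp only [hx, RCLike.inner_apply, Pi.star_apply, RCLike.star_def, Complex.conj_conj]
  simp only [h1]
  fun_prop

/-- Functions in `L²` that agree as distributions agree almost everywhere. -/
theorem ae_eq_mul_of_integral {c : Space d → ℂ} (hc : MemL2Loc c) {f g : L2 d}
    (hfg : ∀ φ : Space d → ℂ, IsTestFunction φ → ∫ x, f x * φ x = ∫ x, g x * (c x * φ x)) :
    (f : Space d → ℂ) =ᵐ[volume] fun x => c x * g x := by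
  have hloc : LocallyIntegrable (fun x => c x * g x) volume := by
    refine locallyIntegrable_iff.2 fun K hK => ?_
    have h1 := ((memLp_indicator_of_memL2Loc hc hK).integrable_mul (Lp.memLp g)).integrableOn
      (s := K)
    refine h1.congr_fun (fun x hx => ?_) hK.measurableSet
    simp [Set.indicator_of_mem hx]
  have hfl : LocallyIntegrable (f : Space d → ℂ) volume :=
    (Lp.memLp f).locallyIntegrable (by norm_num)
  have key : ∀ᵐ x, f x - c x * g x = 0 := by
    refine ae_eq_zero_of_integral_contDiff_smul_eq_zero (hfl.sub hloc) fun k hk hkc => ?_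
    have hφ : IsTestFunction (fun x => (k x : ℂ)) :=
      ⟨Complex.ofRealCLM.contDiff.comp hk, hkc.comp_left (g := Complex.ofReal) rfl⟩
    have i2 : Integrable (fun x => g x * (c x * k x)) :=
      (Lp.memLp g).integrable_mul (hc.memLp_mul hφ)
    rw [← sub_eq_zero.2 (hfg _ hφ), ← integral_sub (integrable_mul_test f hφ) i2]
    refine integral_congr_ae (ae_of_all _ fun x => ?_)
    simp only [Complex.real_smul]
    ring
  filter_upwards [key] with x hx
  exact sub_eq_zero.1 hx

/-- Fatou's lemma for a sequence with convergent upper bounds of its integrals. -/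
theorem integral_le_of_tendsto_ae {α : Type*} [MeasurableSpace α] {μ : Measure α}
    {f : ℕ → α → ℝ} {g : α → ℝ} {r : ℕ → ℝ} {R : ℝ} (hf : ∀ n, Integrable (f n) μ)
    (hf0 : ∀ n x, 0 ≤ f n x) (hg : Integrable g μ)
    (hlim : ∀ᵐ x ∂μ, Tendsto (fun n => f n x) atTop (𝓝 (g x)))
    (hr : ∀ n, ∫ x, f n x ∂μ ≤ r n) (hR : Tendsto r atTop (𝓝 R)) : ∫ x, g x ∂μ ≤ R := by
  have hg0 : ∀ᵐ x ∂μ, 0 ≤ g x := by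
    filter_upwards [hlim] with x hx
    exact ge_of_tendsto' hx fun n => hf0 n x
  have hR0 : 0 ≤ R := ge_of_tendsto' hR fun n => (integral_nonneg (hf0 n)).trans (hr n)
  rw [← ENNReal.ofReal_le_ofReal_iff hR0, ofReal_integral_eq_lintegral_ofReal hg hg0]
  calc ∫⁻ x, ENNReal.ofReal (g x) ∂μ
      = ∫⁻ x, liminf (fun n => ENNReal.ofReal (f n x)) atTop ∂μ := by
        refine lintegral_congr_ae ?_
        filter_upwards [hlim] with x hx
        exact ((ENNReal.continuous_ofReal.tendsto _).comp hx).liminf_eq.symm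
    _ ≤ liminf (fun n => ∫⁻ x, ENNReal.ofReal (f n x) ∂μ) atTop :=
        lintegral_liminf_le' fun n => (hf n).1.aemeasurable.ennreal_ofReal
    _ ≤ liminf (fun n => ENNReal.ofReal (r n)) atTop := by
        refine liminf_le_liminf (Eventually.of_forall fun n => ?_)
        rw [← ofReal_integral_eq_lintegral_ofReal (hf n) (ae_of_all _ (hf0 n))]
        exact ENNReal.ofReal_le_ofReal (hr n)
    _ = ENNReal.ofReal R := ((ENNReal.continuous_ofReal.tendsto _).comp hR).liminf_eq

theorem isWeakMagneticDeriv_of_tendsto {c : Space d → ℂ} (hc : MemL2Loc c) {j : Fin d}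
    {u w : ℕ → L2 d} {u₀ w₀ : L2 d} (huw : ∀ n, IsWeakMagneticDeriv h c j (u n) (w n))
    (hu : Tendsto u atTop (𝓝 u₀)) (hw : Tendsto w atTop (𝓝 w₀)) :
    IsWeakMagneticDeriv h c j u₀ w₀ := by
  intro φ hφ
  have h1 := ((continuous_integral_mul hφ.memLp).tendsto w₀).comp hw
  have h2 := ((continuous_integral_mul (((hφ.memLp_partialDeriv j).const_mul
    (Complex.I * h)).sub (hc.memLp_mul hφ))).tendsto u₀).comp hu
  refine tendsto_nhds_unique h1 (h2.congr fun n => ?_)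
  exact (huw n φ hφ).symm

theorem IsWeakMagneticDeriv.unique {c : Space d → ℂ} (hc : MemL2Loc c) {j : Fin d} {u w w' : L2 d}
    (hw : IsWeakMagneticDeriv h c j u w) (hw' : IsWeakMagneticDeriv h c j u w') : w = w' := by
  have h1 : (u, w) ∈ (weakDeriv h hc j).graph := by
    rw [graph_weakDeriv]
    exact hw
  have h2 : (u, w') ∈ (weakDeriv h hc j).graph := by
    rw [graph_weakDeriv]
    exact hw'
  exact LinearPMap.mem_graph_snd_inj _ h1 h2 rfl

theorem isWeakMagneticDeriv_test {c : Space d → ℂ} (hc : MemL2Loc c) {φ : Space d → ℂ}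
    (hφ : IsTestFunction φ) (j : Fin d) :
    IsWeakMagneticDeriv h c j (hφ.memLp.toLp φ) ((memLp_magneticDeriv hc h hφ j).toLp _) := by
  refine isWeakMagneticDeriv_toLp _ _ fun ψ hψ => ?_
  have hparts : ∫ x, φ x * partialDeriv j ψ x = -∫ x, partialDeriv j φ x * ψ x :=
    integral_mul_fderiv_eq_neg_fderiv_mul_of_integrable (𝕜 := ℂ) (μ := volume)
      ((hφ.memLp_partialDeriv j).integrable_mul hψ.memLp)
      (hφ.memLp.integrable_mul (hψ.memLp_partialDeriv j)) (hφ.memLp.integrable_mul hψ.memLp)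
      (fun x _ => hφ.1.differentiable (by simp) x) (fun x _ => hψ.1.differentiable (by simp) x)
  have i1 : Integrable (fun x => partialDeriv j φ x * ψ x) :=
    (hφ.memLp_partialDeriv j).integrable_mul hψ.memLp
  have i2 : Integrable (fun x => φ x * partialDeriv j ψ x) :=
    hφ.memLp.integrable_mul (hψ.memLp_partialDeriv j)
  have i3 : Integrable (fun x => c x * φ x * ψ x) := (hc.memLp_mul hφ).integrable_mul hψ.memLp
  have e1 : ∫ x, (-Complex.I * h * partialDeriv j φ x - c x * φ x) * ψ x =
      -Complex.I * h * (∫ x, partialDeriv j φ x * ψ x) - ∫ x, c x * φ x * ψ x := by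
    rw [← integral_const_mul, ← integral_sub (i1.const_mul _) i3]
    refine integral_congr_ae (ae_of_all _ fun x => ?_)
    ring
  have e2 : ∫ x, φ x * (Complex.I * h * partialDeriv j ψ x - c x * ψ x) =
      Complex.I * h * (∫ x, φ x * partialDeriv j ψ x) - ∫ x, c x * φ x * ψ x := by
    rw [← integral_const_mul, ← integral_sub (i2.const_mul _) i3]
    refine integral_congr_ae (ae_of_all _ fun x => ?_)
    ring
  rw [e1, e2, hparts]
  ring

/-! ### The real and imaginary parts of the magnetic form -/

variable {A : Space d → EuclideanSpace ℂ (Fin d)}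

/-- `u ↦ (-i h ∂_j - Re A_j) u` on the form domain, written as the mean of the derivatives with
potentials `A` and `conj A`. -/
noncomputable def derivRe (h : ℝ) (hA : MemL2Loc A) (j : Fin d) : formDomain h hA →ₗ[ℂ] L2 d :=
  (1 / 2 : ℂ) • (derivA h hA j + derivConjA h hA j)

/-- `u ↦ (Im A_j) u` on the form domain, written in terms of the derivatives with potentials `A`
and `conj A`. -/
noncomputable def mulIm (h : ℝ) (hA : MemL2Loc A) (j : Fin d) : formDomain h hA →ₗ[ℂ] L2 d :=
  (Complex.I / 2) • (derivA h hA j - derivConjA h hA j)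

theorem derivA_eq (hA : MemL2Loc A) (j : Fin d) (u : formDomain h hA) :
    derivA h hA j u = derivRe h hA j u - Complex.I • mulIm h hA j u := by
  simp only [derivRe, mulIm, LinearMap.smul_apply, LinearMap.add_apply, LinearMap.sub_apply,
    smul_smul]
  rw [← mul_div_assoc, Complex.I_mul_I]
  module

theorem derivConjA_eq (hA : MemL2Loc A) (j : Fin d) (u : formDomain h hA) :
    derivConjA h hA j u = derivRe h hA j u + Complex.I • mulIm h hA j u := by
  simp only [derivRe, mulIm, LinearMap.smul_apply, LinearMap.add_apply, LinearMap.sub_apply,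
    smul_smul]
  rw [← mul_div_assoc, Complex.I_mul_I]
  module

theorem derivA_spec (hA : MemL2Loc A) (j : Fin d) (u : formDomain h hA) :
    IsWeakMagneticDeriv h (comp A j) j u (derivA h hA j u) :=
  weakDeriv_spec h (hA.comp j) j (Submodule.inclusion (formDomain_le h hA j) u)

theorem derivConjA_spec (hA : MemL2Loc A) (j : Fin d) (u : formDomain h hA) :
    IsWeakMagneticDeriv h (conjComp A j) j u (derivConjA h hA j u) :=
  weakDeriv_spec h (hA.conjComp j) j (Submodule.inclusion (formDomain_le_conj h hA j) u)

theorem derivRe_spec (hA : MemL2Loc A) (j : Fin d) (u : formDomain h hA) :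
    IsWeakMagneticDeriv h (reComp A j) j u (derivRe h hA j u) := by
  intro φ hφ
  have e1 : ∫ x, derivRe h hA j u x * φ x = 1 / 2 * ((∫ x, derivA h hA j u x * φ x) +
      ∫ x, derivConjA h hA j u x * φ x) := by
    rw [← integral_add (integrable_mul_test _ hφ) (integrable_mul_test _ hφ),
      ← integral_const_mul]
    refine integral_congr_ae ?_
    filter_upwards [Lp.coeFn_smul (1 / 2 : ℂ) (derivA h hA j u + derivConjA h hA j u),
      Lp.coeFn_add (derivA h hA j u) (derivConjA h hA j u)] with x h1 h2
    simp only [derivRe, LinearMap.smul_apply, LinearMap.add_apply, h1, h2, Pi.smul_apply,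
      Pi.add_apply, smul_eq_mul]
    ring
  rw [e1, derivA_spec hA j u φ hφ, derivConjA_spec hA j u φ hφ,
    ← integral_add (integrable_weak (hA.comp j) h j _ hφ)
      (integrable_weak (hA.conjComp j) h j _ hφ), ← integral_const_mul]
  refine integral_congr_ae (ae_of_all _ fun x => ?_)
  simp only [comp, conjComp, reComp, Complex.re_eq_add_conj]
  ring

theorem mulIm_ae_eq (hA : MemL2Loc A) (j : Fin d) (u : formDomain h hA) :
    (mulIm h hA j u : Space d → ℂ) =ᵐ[volume] fun x => imComp A j x * (u : L2 d) x := by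
  refine ae_eq_mul_of_integral (hA.imComp j) fun φ hφ => ?_
  have e1 : ∫ x, mulIm h hA j u x * φ x = Complex.I / 2 * ((∫ x, derivA h hA j u x * φ x) -
      ∫ x, derivConjA h hA j u x * φ x) := by
    rw [← integral_sub (integrable_mul_test _ hφ) (integrable_mul_test _ hφ),
      ← integral_const_mul]
    refine integral_congr_ae ?_
    filter_upwards [Lp.coeFn_smul (Complex.I / 2) (derivA h hA j u - derivConjA h hA j u),
      Lp.coeFn_sub (derivA h hA j u) (derivConjA h hA j u)] with x h1 h2
    simp only [mulIm, LinearMap.smul_apply, LinearMap.sub_apply, h1, h2, Pi.smul_apply,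
      Pi.sub_apply, smul_eq_mul]
    ring
  rw [e1, derivA_spec hA j u φ hφ, derivConjA_spec hA j u φ hφ,
    ← integral_sub (integrable_weak (hA.comp j) h j _ hφ)
      (integrable_weak (hA.conjComp j) h j _ hφ), ← integral_const_mul]
  refine integral_congr_ae (ae_of_all _ fun x => ?_)
  simp only [comp, conjComp, imComp, Complex.im_eq_sub_conj]
  field_simp
  ring_nf
  simp only [Complex.I_sq]
  ring

/-- `‖(-i h ∇ - Re A) u‖²`. -/
noncomputable def kineticSq (hA : MemL2Loc A) (u : formDomain h hA) : ℝ :=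
  ∑ j, ‖derivRe h hA j u‖ ^ 2

/-- `‖(Im A) u‖²`. -/
noncomputable def imSq (hA : MemL2Loc A) (u : formDomain h hA) : ℝ :=
  ∑ j, ‖mulIm h hA j u‖ ^ 2

theorem kineticSq_nonneg (hA : MemL2Loc A) (u : formDomain h hA) : 0 ≤ kineticSq hA u :=
  Finset.sum_nonneg fun _ _ => sq_nonneg _

theorem imSq_nonneg (hA : MemL2Loc A) (u : formDomain h hA) : 0 ≤ imSq hA u :=
  Finset.sum_nonneg fun _ _ => sq_nonneg _

theorem inner_add_I_smul_sub_I_smul {E : Type*} [NormedAddCommGroup E] [InnerProductSpace ℂ E]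
    (x y : E) : inner ℂ (x + Complex.I • y) (x - Complex.I • y) =
      ((‖x‖ ^ 2 - ‖y‖ ^ 2 : ℝ) : ℂ) - Complex.I * ((2 * (inner ℂ x y).re : ℝ) : ℂ) := by
  have h1 : inner ℂ x y + inner ℂ y x = ((2 * (inner ℂ x y).re : ℝ) : ℂ) := by
    rw [← inner_conj_symm y x, Complex.add_conj]
  have h2 (z : E) : inner ℂ z z = ((‖z‖ ^ 2 : ℝ) : ℂ) := by
    rw [inner_self_eq_norm_sq_to_K]
    norm_cast
  rw [← h1, inner_add_left, inner_sub_right, inner_sub_right, inner_smul_left, inner_smul_left,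
    inner_smul_right, inner_smul_right, h2, h2, Complex.conj_I]
  push_cast
  linear_combination (‖y‖ : ℂ) ^ 2 * Complex.I_mul_I

theorem magneticForm_form (hA : MemL2Loc A) (u v : formDomain h hA) :
    (magneticForm h hA).form u v = ∑ j, inner ℂ (derivConjA h hA j v) (derivA h hA j u) := rfl

theorem re_magneticForm (hA : MemL2Loc A) (u : formDomain h hA) :
    ((magneticForm h hA).form u u).re = kineticSq hA u - imSq hA u := by
  rw [magneticForm_form, Complex.re_sum, kineticSq, imSq, ← Finset.sum_sub_distrib]
  refine Finset.sum_congr rfl fun j _ => ?_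
  rw [derivA_eq, derivConjA_eq, inner_add_I_smul_sub_I_smul, Complex.sub_re, Complex.ofReal_re,
    Complex.I_mul_re, Complex.ofReal_im, neg_zero, sub_zero]

theorem abs_im_magneticForm_le (hA : MemL2Loc A) (u : formDomain h hA) :
    |((magneticForm h hA).form u u).im| ≤ kineticSq hA u + imSq hA u := by
  rw [magneticForm_form, Complex.im_sum, kineticSq, imSq, ← Finset.sum_add_distrib]
  refine (Finset.abs_sum_le_sum_abs _ _).trans (Finset.sum_le_sum fun j _ => ?_)
  rw [derivA_eq, derivConjA_eq, inner_add_I_smul_sub_I_smul]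
  have h1 := (Complex.abs_re_le_norm _).trans
    (norm_inner_le_norm (𝕜 := ℂ) (derivRe h hA j u) (mulIm h hA j u))
  have h2 := two_mul_le_add_sq ‖derivRe h hA j u‖ ‖mulIm h hA j u‖
  have h3 : (((‖derivRe h hA j u‖ ^ 2 - ‖mulIm h hA j u‖ ^ 2 : ℝ) : ℂ) - Complex.I *
      ((2 * (inner ℂ (derivRe h hA j u) (mulIm h hA j u)).re : ℝ) : ℂ)).im =
      -(2 * (inner ℂ (derivRe h hA j u) (mulIm h hA j u)).re) := by
    rw [Complex.sub_im, Complex.ofReal_im, Complex.I_mul_im, Complex.ofReal_re, zero_sub]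
  rw [h3, abs_neg, abs_mul, abs_two]
  linarith

end Magnetic

namespace Magnetic

variable {d : ℕ} {h : ℝ} {A : Space d → EuclideanSpace ℂ (Fin d)}

theorem sum_norm_sq_eq_integral (w : Fin d → L2 d) :
    ∑ j, ‖w j‖ ^ 2 = ∫ x, ∑ j, ‖w j x‖ ^ 2 := by
  rw [integral_finsetSum _ fun j _ => integrable_norm_sq (Lp.memLp (w j))]
  exact Finset.sum_congr rfl fun j _ => norm_sq_eq_integral (w j)

/-- The form bound on `Im A` extends from the test functions to the form domain, by density of the
test functions and Fatou's lemma. -/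
theorem imSq_le (hh : h ≠ 0) (hA : MemL2Loc A) {a b : ℝ}
    (hbound : ∀ φ : Space d → ℂ, IsTestFunction φ → ∫ x, ∑ j, ‖imComp A j x * φ x‖ ^ 2 ≤
      a * (∫ x, ∑ j, ‖-Complex.I * h * partialDeriv j φ x - reComp A j x * φ x‖ ^ 2) +
        b * ∫ x, ‖φ x‖ ^ 2) (u : formDomain h hA) :
    imSq hA u ≤ a * kineticSq hA u + b * ‖(u : L2 d)‖ ^ 2 := by
  have hmem := mem_closure_testGraph hh hA.reComp (fun j x => by simp [reComp])
    (u := (u : L2 d)) (w := fun j => derivRe h hA j u) (fun j => derivRe_spec hA j u)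
  obtain ⟨p, hp, hlim⟩ := mem_closure_iff_seq_limit.1 hmem
  choose φ hφ hφ1 hφ2 using hp
  have hlim1 : Tendsto (fun n => (p n).1) atTop (𝓝 (u : L2 d)) :=
    (continuous_fst.tendsto _).comp hlim
  have hlim2 (j : Fin d) : Tendsto (fun n => (p n).2 j) atTop (𝓝 (derivRe h hA j u)) :=
    (((continuous_apply j).comp continuous_snd).tendsto _).comp hlim
  obtain ⟨ns, hns, hae⟩ := (tendstoInMeasure_of_tendsto_Lp hlim1).exists_seq_tendsto_ae
  have hφae : ∀ᵐ x, Tendsto (fun i => φ (ns i) x) atTop (𝓝 ((u : L2 d) x)) := by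
    filter_upwards [hae, ae_all_iff.2 hφ1] with x hx hx'
    refine hx.congr fun i => ?_
    exact hx' (ns i)
  have hB (j : Fin d) : MemLp (fun x => imComp A j x * (u : L2 d) x) 2 volume :=
    ((mem_formDomain h hA u).1 u.2).2 j
  have himSq : imSq hA u = ∫ x, ∑ j, ‖imComp A j x * (u : L2 d) x‖ ^ 2 := by
    rw [imSq, sum_norm_sq_eq_integral]
    refine integral_congr_ae ?_
    filter_upwards [ae_all_iff.2 fun j => mulIm_ae_eq hA j u] with x hx
    simp only [hx]
  rw [himSq]
  refine integral_le_of_tendsto_ae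
    (f := fun i x => ∑ j, ‖imComp A j x * φ (ns i) x‖ ^ 2)
    (r := fun i => a * ∑ j, ‖(p (ns i)).2 j‖ ^ 2 + b * ‖(p (ns i)).1‖ ^ 2)
    (fun i => integrable_finsetSum _ fun j _ =>
      integrable_norm_sq ((hA.imComp j).memLp_mul (hφ (ns i))))
    (fun i x => Finset.sum_nonneg fun j _ => sq_nonneg _)
    (integrable_finsetSum _ fun j _ => integrable_norm_sq (hB j)) ?_ (fun i => ?_) ?_
  · filter_upwards [hφae] with x hx
    exact tendsto_finsetSum _ fun j _ => ((hx.const_mul _).norm.pow 2)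
  · refine (hbound _ (hφ (ns i))).trans_eq ?_
    rw [sum_norm_sq_eq_integral, norm_sq_eq_integral]
    congr 2
    · refine integral_congr_ae ?_
      filter_upwards [ae_all_iff.2 (hφ2 (ns i))] with x hx
      simp only [hx]
    · refine integral_congr_ae ?_
      filter_upwards [hφ1 (ns i)] with x hx
      simp only [hx]
  · refine Tendsto.add (Tendsto.const_mul a ?_) (Tendsto.const_mul b ?_)
    · exact tendsto_finsetSum _ fun j _ => (((hlim2 j).comp hns.tendsto_atTop).norm.pow 2)
    · exact (hlim1.comp hns.tendsto_atTop).norm.pow 2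

/-! ### Properties of the magnetic form -/

theorem toLp_mem_formDomain (hA : MemL2Loc A) {φ : Space d → ℂ} (hφ : IsTestFunction φ) :
    hφ.memLp.toLp φ ∈ formDomain h hA := by
  rw [mem_formDomain]
  refine ⟨fun j => ⟨_, isWeakMagneticDeriv_test (hA.reComp j) hφ j⟩, fun j => ?_⟩
  refine ((hA.imComp j).memLp_mul hφ).ae_eq ?_
  filter_upwards [hφ.memLp.coeFn_toLp] with x hx
  rw [hx]

theorem isDenselyDefined_magneticForm (hA : MemL2Loc A) :
    (magneticForm h hA).IsDenselyDefined := by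
  change Dense (formDomain h hA : Set (L2 d))
  rw [Submodule.dense_iff_topologicalClosure_eq_top, Submodule.topologicalClosure_eq_top_iff,
    Submodule.eq_bot_iff]
  intro g hg
  rw [Lp.eq_zero_iff_ae_eq_zero]
  refine ae_eq_zero_of_integral_contDiff_smul_eq_zero
    ((Lp.memLp g).locallyIntegrable (by norm_num)) fun k hk hkc => ?_
  have hφ : IsTestFunction (fun x => (k x : ℂ)) :=
    ⟨Complex.ofRealCLM.contDiff.comp hk, hkc.comp_left (g := Complex.ofReal) rfl⟩
  have h1 := (Submodule.mem_orthogonal _ _).1 hg _ (toLp_mem_formDomain (h := h) hA hφ)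
  rw [L2.inner_def] at h1
  rw [← h1]
  refine integral_congr_ae ?_
  filter_upwards [hφ.memLp.coeFn_toLp] with x hx
  rw [hx]
  simp [mul_comm]

theorem cauchySeq_of_sum_norm_sq {E V : Type*} [NormedAddCommGroup E] [AddCommGroup V]
    [Module ℂ E] [Module ℂ V] {ι : Type*} [Fintype ι] (L : ι → V →ₗ[ℂ] E) {u : ℕ → V}
    (hu : Tendsto (fun p : ℕ × ℕ => ∑ i, ‖L i (u p.1 - u p.2)‖ ^ 2) atTop (𝓝 0)) (i : ι) :
    CauchySeq fun n => L i (u n) := by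
  rw [cauchySeq_iff_tendsto_dist_atTop_0]
  have h1 : Tendsto (fun p : ℕ × ℕ => ‖L i (u p.1 - u p.2)‖ ^ 2) atTop (𝓝 0) :=
    squeeze_zero (fun _ => sq_nonneg _) (fun p => Finset.single_le_sum
      (f := fun i => ‖L i (u p.1 - u p.2)‖ ^ 2) (fun _ _ => sq_nonneg _) (Finset.mem_univ i)) hu
  have h2 := h1.sqrt
  simpa [dist_eq_norm] using h2

theorem isClosed_magneticForm (hA : MemL2Loc A) {a b : ℝ} (ha1 : a < 1)
    (hB : ∀ u : formDomain h hA, imSq hA u ≤ a * kineticSq hA u + b * ‖(u : L2 d)‖ ^ 2) :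
    (magneticForm h hA).IsClosed := by
  intro (u : ℕ → formDomain h hA) x hux hform
  have hnorm : Tendsto (fun p : ℕ × ℕ => ‖((u p.1 - u p.2 : formDomain h hA) : L2 d)‖ ^ 2) atTop
      (𝓝 0) := by
    have h1 : Tendsto (fun p : ℕ × ℕ => (u p.1 : L2 d) - u p.2) atTop (𝓝 0) := by
      rw [← sub_self x, ← prod_atTop_atTop_eq]
      exact (hux.comp tendsto_fst).sub (hux.comp tendsto_snd)
    simpa using h1.norm.pow 2
  have hkin : Tendsto (fun p : ℕ × ℕ => kineticSq hA (u p.1 - u p.2)) atTop (𝓝 0) := by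
    have h1 := (((Complex.continuous_re.tendsto _).comp hform).add
      (hnorm.const_mul b)).const_mul (1 - a)⁻¹
    simp only [Complex.zero_re, mul_zero, add_zero] at h1
    refine squeeze_zero (fun p => kineticSq_nonneg hA _) (fun p => ?_) h1
    rw [le_inv_mul_iff₀ (by linarith)]
    have h2 := hB (u p.1 - u p.2)
    change (1 - a) * kineticSq hA (u p.1 - u p.2) ≤
      ((magneticForm h hA).form (u p.1 - u p.2) (u p.1 - u p.2)).re +
        b * ‖((u p.1 - u p.2 : formDomain h hA) : L2 d)‖ ^ 2
    rw [re_magneticForm]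
    linarith
  have him : Tendsto (fun p : ℕ × ℕ => imSq hA (u p.1 - u p.2)) atTop (𝓝 0) := by
    have h1 := (hkin.const_mul a).add (hnorm.const_mul b)
    simp only [mul_zero, add_zero] at h1
    exact squeeze_zero (fun p => imSq_nonneg hA _) (fun p => hB _) h1
  choose w hw using fun j => cauchySeq_tendsto_of_complete
    (cauchySeq_of_sum_norm_sq (derivRe h hA) hkin j)
  choose β hβ using fun j => cauchySeq_tendsto_of_complete
    (cauchySeq_of_sum_norm_sq (mulIm h hA) him j)
  have hxw (j : Fin d) : IsWeakMagneticDeriv h (reComp A j) j x (w j) :=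
    isWeakMagneticDeriv_of_tendsto (hA.reComp j) (fun n => derivRe_spec hA j (u n)) hux (hw j)
  have hxβ (j : Fin d) : (β j : Space d → ℂ) =ᵐ[volume] fun y => imComp A j y * x y := by
    refine ae_eq_mul_of_integral (hA.imComp j) fun φ hφ => ?_
    have h1 := ((continuous_integral_mul hφ.memLp).tendsto (β j)).comp (hβ j)
    have h2 := ((continuous_integral_mul ((hA.imComp j).memLp_mul hφ)).tendsto x).comp hux
    refine tendsto_nhds_unique h1 (h2.congr fun n => ?_)
    refine integral_congr_ae ?_
    filter_upwards [mulIm_ae_eq hA j (u n)] with y hy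
    rw [hy]
    ring
  have hx : x ∈ formDomain h hA := by
    rw [mem_formDomain]
    exact ⟨fun j => ⟨w j, hxw j⟩, fun j => (Lp.memLp (β j)).ae_eq (hxβ j)⟩
  refine ⟨hx, ?_⟩
  have hwx (j : Fin d) : derivRe h hA j ⟨x, hx⟩ = w j :=
    (derivRe_spec hA j ⟨x, hx⟩).unique (hA.reComp j) (hxw j)
  have hβx (j : Fin d) : mulIm h hA j ⟨x, hx⟩ = β j :=
    Lp.ext ((mulIm_ae_eq hA j ⟨x, hx⟩).trans (hxβ j).symm)
  have hD (j : Fin d) : Tendsto (fun n => derivRe h hA j (u n - ⟨x, hx⟩)) atTop (𝓝 0) := by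
    simp only [map_sub, hwx]
    simpa using (hw j).sub_const (w j)
  have hI (j : Fin d) : Tendsto (fun n => mulIm h hA j (u n - ⟨x, hx⟩)) atTop (𝓝 0) := by
    simp only [map_sub, hβx]
    simpa using (hβ j).sub_const (β j)
  have hterm (j : Fin d) : Tendsto (fun n => (inner ℂ (derivConjA h hA j (u n - ⟨x, hx⟩))
      (derivA h hA j (u n - ⟨x, hx⟩)) : ℂ)) atTop (𝓝 0) := by
    simp only [derivA_eq, derivConjA_eq]
    have h1 := (hD j).add ((hI j).const_smul Complex.I)
    have h2 := (hD j).sub ((hI j).const_smul Complex.I)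
    simpa only [smul_zero, add_zero, sub_zero, inner_zero_right] using
      Tendsto.inner (𝕜 := ℂ) h1 h2
  have hsum := tendsto_finsetSum Finset.univ fun j _ => hterm j
  rw [Finset.sum_const_zero] at hsum
  exact hsum

theorem isSectorial_magneticForm (hA : MemL2Loc A) {a b : ℝ} (ha0 : 0 < a) (ha1 : a < 1)
    (hb : 0 ≤ b)
    (hB : ∀ u : formDomain h hA, imSq hA u ≤ a * kineticSq hA u + b * ‖(u : L2 d)‖ ^ 2) :
    (magneticForm h hA).IsSectorial := by
  -- With `M = (1 + a) / (1 - a)`, the bound on `Im A` gives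
  -- `|Im Q(u, u)| ≤ M Re Q(u, u) + (M + 1) b ‖u‖²`.
  set M : ℝ := (1 + a) / (1 - a) with hM
  have h1a : 0 < 1 - a := by linarith
  have hM1 : 1 ≤ M := by
    rw [hM, le_div_iff₀ h1a]
    linarith
  have hMa : M * (1 - a) = 1 + a := div_mul_cancel₀ _ h1a.ne'
  refine ⟨-((M + 1) * b), Real.arctan M, Real.arctan_nonneg.2 (by linarith),
    Real.arctan_lt_pi_div_two M, ?_⟩
  rintro z ⟨u, hu, rfl⟩
  have h2 := hB u
  have h3 := abs_im_magneticForm_le hA u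
  have h4 := re_magneticForm hA u
  have h5 := kineticSq_nonneg hA u
  have hu' : ‖(u : L2 d)‖ ^ 2 = 1 := by rw [hu, one_pow]
  rw [hu', mul_one] at h2
  have hMb : 0 ≤ M * b := mul_nonneg (by linarith) hb
  have him : ((magneticForm h hA).form u u - ((-((M + 1) * b) : ℝ) : ℂ)).im =
      ((magneticForm h hA).form u u).im := by
    rw [Complex.sub_im, Complex.ofReal_im, sub_zero]
  have hre : ((magneticForm h hA).form u u - ((-((M + 1) * b) : ℝ) : ℂ)).re =
      kineticSq hA u - imSq hA u + (M + 1) * b := by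
    rw [Complex.sub_re, Complex.ofReal_re, h4, sub_neg_eq_add]
  refine abs_arg_le_arctan ?_ (by linarith) ?_
  · rw [hre]
    nlinarith [mul_nonneg h1a.le h5]
  · rw [hre, him]
    refine h3.trans ?_
    have h6 : (M + 1) * imSq hA u ≤ (M + 1) * (a * kineticSq hA u + b) :=
      mul_le_mul_of_nonneg_left h2 (by linarith)
    have h7 : M * (1 - a) * kineticSq hA u = (1 + a) * kineticSq hA u := by rw [hMa]
    nlinarith [mul_nonneg (sub_nonneg.2 hM1) (mul_nonneg (by linarith : 0 ≤ M + 1) hb)]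

/-- `u ↦ (-i h ∇ - A) u` as a map into `L²(ℝ^d, ℂ^d)`. -/
noncomputable def gradA (h : ℝ) (hA : MemL2Loc A) :
    formDomain h hA →ₗ[ℂ] PiLp 2 (fun _ : Fin d => L2 d) :=
  (WithLp.linearEquiv 2 ℂ (Fin d → L2 d)).symm.toLinearMap ∘ₗ LinearMap.pi (derivA h hA)

/-- `u ↦ (-i h ∇ - conj A) u` as a map into `L²(ℝ^d, ℂ^d)`. -/
noncomputable def gradConjA (h : ℝ) (hA : MemL2Loc A) :
    formDomain h hA →ₗ[ℂ] PiLp 2 (fun _ : Fin d => L2 d) :=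
  (WithLp.linearEquiv 2 ℂ (Fin d → L2 d)).symm.toLinearMap ∘ₗ LinearMap.pi (derivConjA h hA)

theorem magneticForm_eq_inner (hA : MemL2Loc A) (u v : formDomain h hA) :
    (magneticForm h hA).form u v = inner ℂ (gradConjA h hA v) (gradA h hA u) := by
  rw [PiLp.inner_apply]
  rfl

/-- The parallelogram law for `D u ± i (Im A) u` with `D = -i h ∇ - Re A`. -/
theorem norm_sq_gradA_add (hA : MemL2Loc A) (u : formDomain h hA) :
    ‖gradA h hA u‖ ^ 2 + ‖gradConjA h hA u‖ ^ 2 = 2 * kineticSq hA u + 2 * imSq hA u := by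
  rw [PiLp.norm_sq_eq_of_L2, PiLp.norm_sq_eq_of_L2, kineticSq, imSq, Finset.mul_sum,
    Finset.mul_sum, ← Finset.sum_add_distrib, ← Finset.sum_add_distrib]
  refine Finset.sum_congr rfl fun j _ => ?_
  change ‖derivA h hA j u‖ ^ 2 + ‖derivConjA h hA j u‖ ^ 2 = _
  rw [derivA_eq, derivConjA_eq]
  have h1 := parallelogram_law_with_norm ℂ (derivRe h hA j u) (Complex.I • mulIm h hA j u)
  rw [norm_smul, Complex.norm_I, one_mul] at h1
  linarith

/-- The form controls the graph norm. -/
theorem coercive_magneticForm (hA : MemL2Loc A) {a b : ℝ} (ha0 : 0 < a) (ha1 : a < 1)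
    (hb : 0 ≤ b)
    (hB : ∀ u : formDomain h hA, imSq hA u ≤ a * kineticSq hA u + b * ‖(u : L2 d)‖ ^ 2)
    (u : formDomain h hA) :
    (1 - a) / 4 * (‖gradA h hA u‖ ^ 2 + ‖gradConjA h hA u‖ ^ 2 + ‖(u : L2 d)‖ ^ 2) ≤
      ((magneticForm h hA).form u u).re + (2 * b + 1) * ‖(u : L2 d)‖ ^ 2 := by
  rw [norm_sq_gradA_add, re_magneticForm]
  have h2 := kineticSq_nonneg hA u
  have h3 : 0 ≤ ‖(u : L2 d)‖ ^ 2 := sq_nonneg _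
  have h4 : (3 - a) / 2 * imSq hA u ≤
      (3 - a) / 2 * (a * kineticSq hA u + b * ‖(u : L2 d)‖ ^ 2) :=
    mul_le_mul_of_nonneg_left (hB u) (by linarith)
  -- The coefficient of `kineticSq hA u` that remains is `(1 - a)² / 2`.
  nlinarith [mul_nonneg (sq_nonneg (1 - a)) h2, mul_nonneg hb h3, mul_nonneg ha0.le h3,
    mul_nonneg (mul_nonneg ha0.le hb) h3]

end Magnetic

theorem theorem1p2 (d : ℕ) (hd : 1 ≤ d) (h : ℝ) (hh : 0 < h)
    (A : Magnetic.Space d → EuclideanSpace ℂ (Fin d)) (hA : Magnetic.MemL2Loc A)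
    (hbound : Magnetic.ImFormBounded h A) :
    (Magnetic.magneticForm h hA).IsDenselyDefined ∧
      (Magnetic.magneticForm h hA).IsClosed ∧
      (Magnetic.magneticForm h hA).IsSectorial ∧
      (Magnetic.magneticForm h hA).operator.IsMSectorial := by
  obtain ⟨a, b, ha0, ha1, hb, hab⟩ := hbound
  have hB := Magnetic.imSq_le hh.ne' hA hab
  have hdense := Magnetic.isDenselyDefined_magneticForm (h := h) hA
  have hclosed := Magnetic.isClosed_magneticForm hA ha1 hB
  have hsect := Magnetic.isSectorial_magneticForm hA ha0 ha1 hb hB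
  refine ⟨hdense, hclosed, hsect, ?_⟩
  exact SesqForm.isMSectorial_operator _ hdense hclosed hsect (Magnetic.gradA h hA)
    (Magnetic.gradConjA h hA) (Magnetic.magneticForm_eq_inner hA) (by linarith)
    (Magnetic.coercive_magneticForm hA ha0 ha1 hb hB)
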